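/- Let $n\ge 1$, let $M=\mathbb{CP}^n$, let $L$ be the hyperplane line bundle, so that $L^*$ is the tautological line bundle, whose fibre over a line $\ell\subset\mathbb C^{n+1}$ is $\ell$, and for $\mu=0,1,2,\dots$ let $L^{*\mu}$ be its $\mu$-th tensor power, with the Hermitian metric induced by the standard inner product of $\mathbb C^{n+1}$. Let $D_\mu=\{\xi\in L^{*\mu}:\|\xi\|<1\}$ be the unit disc bundle, $S(L^{*\mu})=\partial D_\mu$ the unit circle bundle, and $\sigma=\pi^*(\omega^n)\wedge\frac{d\theta}{2\pi}$ the invariant probability measure on $S(L^{*\mu})$, where $\pi$ is the projection to $M$ and $\omega^n$ the normalized Fubini–Study volume. Let $H^2$ be the Hardy space, i.e. the closure in $L^2(S(L^{*\mu}),\sigma)$ of the boundary values of the functions that are holomorphic on $D_\mu$ and continuous on $\overline{D_\mu}$, and let $K(\xi,\eta)$, $\xi,\eta\in D_\mu$, be its reproducing kernel (the Szegő kernel). Let $\rho(\xi,\eta)=\langle\xi,\eta\rangle-1$ be the sesquiholomorphic extension of the defining function $\|\xi\|^2-1$, where $\langle a z^{\otimes\mu},b w^{\otimes\mu}\rangle=a\bar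 b\,\langle z,w\rangle^\mu$. Then: (a) for every $\mu\ge 0$ the Szegő kernel $K$ exists and has no logarithmic term: there is a function $\varphi$, of class $C^\infty$ on a neighbourhood $U$ of the diagonal of $S(L^{*\mu})\times S(L^{*\mu})$ in $L^{*\mu}\times L^{*\mu}$, with $$K(\xi,\eta)=\varphi(\xi,\eta)\,(-\rho(\xi,\eta))^{-(n+1)}\qquad\text{for }(\xi,\eta)\in U\cap(D_\mu\times D_\mu),$$ that is, the coefficient $\psi$ in the expansion $K=\varphi\,(-\rho)^{-(n+1)}+\psi\log(-\rho)$ can be taken to be $0$; (b) for every $\mu\ge 1$ the map $z\mapsto(\mathbb Cz,z^{\otimes\mu})$ induces a diffeomorphism of the lens space $S^{2n+1}/\mathbb Z_\mu$, where $\mathbb Z_\mu$ is the group of $\mu$-th roots of unity acting on the unit sphere $S^{2n+1}$ of $\mathbb C^{n+1}$ by multiplication, onto $S(L^{*\mu})$; (c) for every $\mu>1$ the circle bundle $S(L^{*\mu})$ is not diffeomorphic to $S^{2n+1}$. -/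

import Mathlib

open MeasureTheory Metric
open scoped LinearAlgebra.Projectivization Manifold ContDiff Topology ComplexConjugate

noncomputable section

namespace ProjLineBundle

/-! ### Complex projective space -/

/-- `ℂ^{n+1}` with its Hermitian inner product. -/
abbrev Amb (n : ℕ) : Type := EuclideanSpace ℂ (Fin (n + 1))

/-- `ℂP^n`, the space of complex lines in `ℂ^{n+1}`, with the quotient topology. -/
abbrev CP (n : ℕ) : Type := ℙ ℂ (Amb n)

instance (n : ℕ) : TopologicalSpace (CP n) :=
  inferInstanceAs (TopologicalSpace (Quotient (projectivizationSetoid ℂ (Amb n))))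

lemma isQuotientMap_mk' (n : ℕ) :
    Topology.IsQuotientMap (Projectivization.mk' ℂ : {v : Amb n // v ≠ 0} → CP n) :=
  isQuotientMap_quot_mk

lemma continuous_mk {n : ℕ} {α : Type*} [TopologicalSpace α] {f : α → Amb n} (hf : Continuous f)
    (h0 : ∀ a, f a ≠ 0) : Continuous fun a => Projectivization.mk ℂ (f a) (h0 a) :=
  (isQuotientMap_mk' n).continuous.comp (hf.subtype_mk h0)

/-- The standard affine open set `{[z] : z_i ≠ 0}`. -/
def affineSet {n : ℕ} (i : Fin (n + 1)) : Set (CP n) := {ℓ | ℓ.rep i ≠ 0}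

/-- The affine coordinates `z_j / z_i`, `j ≠ i`, of the point `[z]`. -/
def affineCoord {n : ℕ} (i : Fin (n + 1)) (ℓ : CP n) : Fin n → ℂ :=
  fun j => ℓ.rep (i.succAbove j) / ℓ.rep i

/-- The vector with `i`-th coordinate `1` and the remaining coordinates `w`. -/
def affineVec {n : ℕ} (i : Fin (n + 1)) (w : Fin n → ℂ) : Amb n :=
  WithLp.toLp 2 (i.insertNth (α := fun _ => ℂ) 1 w)

@[simp] lemma affineVec_same {n : ℕ} (i : Fin (n + 1)) (w : Fin n → ℂ) : affineVec i w i = 1 := by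
  simp [affineVec]

@[simp] lemma affineVec_succAbove {n : ℕ} (i : Fin (n + 1)) (w : Fin n → ℂ) (j : Fin n) :
    affineVec i w (i.succAbove j) = w j := by
  simp [affineVec]

lemma affineVec_ne_zero {n : ℕ} (i : Fin (n + 1)) (w : Fin n → ℂ) : affineVec i w ≠ 0 := fun h => by
  have := affineVec_same i w
  rw [h] at this
  simp at this

lemma contDiff_affineVec_apply {n : ℕ} (i k : Fin (n + 1)) :
    ContDiff ℂ ω fun w : Fin n → ℂ => affineVec i w k := by
  rcases Fin.eq_self_or_eq_succAbove i k with rfl | ⟨j, rfl⟩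
  · simpa using contDiff_const
  · simpa using contDiff_apply ℂ ℂ j

lemma continuous_affineVec {n : ℕ} (i : Fin (n + 1)) :
    Continuous (affineVec i : (Fin n → ℂ) → Amb n) := by
  refine (PiLp.continuous_toLp 2 _).comp (continuous_pi fun k => ?_)
  exact (contDiff_affineVec_apply i k).continuous

lemma exists_rep_mk {n : ℕ} (v : Amb n) (hv : v ≠ 0) :
    ∃ a : ℂ, a ≠ 0 ∧ (Projectivization.mk ℂ v hv).rep = a • v := by
  obtain ⟨a, ha⟩ := Projectivization.exists_smul_eq_mk_rep ℂ v hv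
  exact ⟨a, a.ne_zero, ha.symm⟩

lemma mk_mem_affineSet {n : ℕ} {i : Fin (n + 1)} {v : Amb n} (hv : v ≠ 0) :
    Projectivization.mk ℂ v hv ∈ affineSet i ↔ v i ≠ 0 := by
  obtain ⟨a, ha, h⟩ := exists_rep_mk v hv
  simp [affineSet, h, ha]

lemma affineCoord_mk {n : ℕ} (i : Fin (n + 1)) {v : Amb n} (hv : v ≠ 0) :
    affineCoord i (Projectivization.mk ℂ v hv) = fun j => v (i.succAbove j) / v i := by
  obtain ⟨a, ha, h⟩ := exists_rep_mk v hv
  funext j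
  simp [affineCoord, h, mul_div_mul_left _ _ ha]

lemma isOpen_affineSet {n : ℕ} (i : Fin (n + 1)) : IsOpen (affineSet i : Set (CP n)) := by
  rw [← (isQuotientMap_mk' n).isOpen_preimage]
  have : (Projectivization.mk' ℂ ⁻¹' affineSet i : Set {v : Amb n // v ≠ 0})
      = {v | v.1 i ≠ 0} := by
    ext v
    exact mk_mem_affineSet v.2
  rw [this]
  exact isOpen_ne_fun (by fun_prop) continuous_const

lemma continuousOn_affineCoord {n : ℕ} (i : Fin (n + 1)) :
    ContinuousOn (affineCoord i : CP n → _) (affineSet i) := by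
  rw [(isQuotientMap_mk' n).continuousOn_isOpen_iff (isOpen_affineSet i)]
  have : (affineCoord i : CP n → _) ∘ (Projectivization.mk' ℂ : {v : Amb n // v ≠ 0} → CP n)
      = fun v j => v.1 (i.succAbove j) / v.1 i := by
    funext v
    exact affineCoord_mk i v.2
  rw [this]
  refine continuousOn_pi.2 fun j => ContinuousOn.div (by fun_prop) (by fun_prop) fun v hv => ?_
  exact (mk_mem_affineSet v.2).1 hv

lemma affineCoord_affineVec {n : ℕ} (i : Fin (n + 1)) (w : Fin n → ℂ) :
    affineCoord i (Projectivization.mk ℂ (affineVec i w) (affineVec_ne_zero i w)) = w := by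
  rw [affineCoord_mk]
  simp

lemma rep_eq_smul_affineVec {n : ℕ} {i : Fin (n + 1)} {ℓ : CP n} (h : ℓ ∈ affineSet i) :
    ℓ.rep = ℓ.rep i • affineVec i (affineCoord i ℓ) := by
  ext k
  rcases Fin.eq_self_or_eq_succAbove i k with rfl | ⟨j, rfl⟩
  · simp
  · have : ℓ.rep i ≠ 0 := h
    simp [affineCoord, mul_div_cancel₀ _ this]

lemma mk_affineVec {n : ℕ} {i : Fin (n + 1)} {ℓ : CP n} (h : ℓ ∈ affineSet i) :
    Projectivization.mk ℂ (affineVec i (affineCoord i ℓ)) (affineVec_ne_zero i _) = ℓ := by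
  conv_rhs => rw [← ℓ.mk_rep]
  rw [Projectivization.mk_eq_mk_iff']
  have h' : ℓ.rep i ≠ 0 := h
  refine ⟨(ℓ.rep i)⁻¹, ?_⟩
  rw [inv_smul_eq_iff₀ h']
  exact rep_eq_smul_affineVec h

/-! ### The powers of the tautological line bundle -/

/-- The tensor power `(ℂ^{n+1})^{⊗μ}`, in coordinates with respect to the standard orthonormal
basis `e_{I 1} ⊗ ⋯ ⊗ e_{I μ}`. -/
abbrev TensorAmb (n μ : ℕ) : Type := EuclideanSpace ℂ (Fin μ → Fin (n + 1))

/-- The tensor `z^{⊗μ} = z ⊗ ⋯ ⊗ z`. -/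
def tpow {n : ℕ} (μ : ℕ) (z : Amb n) : TensorAmb n μ :=
  WithLp.toLp 2 fun I => ∏ k, z (I k)

@[simp] lemma tpow_apply {n μ : ℕ} (z : Amb n) (I : Fin μ → Fin (n + 1)) :
    tpow μ z I = ∏ k, z (I k) := rfl

lemma tpow_smul {n : ℕ} (μ : ℕ) (a : ℂ) (z : Amb n) : tpow μ (a • z) = a ^ μ • tpow μ z := by
  ext I
  simp [Finset.prod_mul_distrib]

lemma continuous_tpow {n : ℕ} (μ : ℕ) : Continuous (tpow μ : Amb n → TensorAmb n μ) :=
  (PiLp.continuous_toLp 2 _).comp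
    (continuous_pi fun _ => continuous_finsetProd _ fun _ _ => by fun_prop)

/-- The fibre `ℓ^{⊗μ}` over the line `ℓ`. -/
def fibre {n : ℕ} (μ : ℕ) (ℓ : CP n) : Submodule ℂ (TensorAmb n μ) :=
  Submodule.span ℂ (tpow μ '' (ℓ.submodule : Set (Amb n)))

lemma fibre_eq {n : ℕ} (μ : ℕ) (ℓ : CP n) : fibre μ ℓ = ℂ ∙ tpow μ ℓ.rep := by
  apply le_antisymm
  · refine Submodule.span_le.2 ?_
    rintro _ ⟨v, hv, rfl⟩
    rw [Projectivization.submodule_eq] at hv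
    obtain ⟨a, rfl⟩ := Submodule.mem_span_singleton.1 hv
    rw [tpow_smul]
    exact Submodule.smul_mem _ _ (Submodule.mem_span_singleton_self _)
  · rw [Submodule.span_singleton_le_iff_mem]
    refine Submodule.subset_span ⟨_, ?_, rfl⟩
    rw [Projectivization.submodule_eq]
    exact Submodule.mem_span_singleton_self _

lemma tpow_mem_fibre {n : ℕ} (μ : ℕ) {v : Amb n} (hv : v ≠ 0) :
    tpow μ v ∈ fibre μ (Projectivization.mk ℂ v hv) := by
  refine Submodule.subset_span ⟨v, ?_, rfl⟩
  rw [Projectivization.submodule_mk]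
  exact Submodule.mem_span_singleton_self _

/-- The total space of `L^{*μ}`, the `μ`-th tensor power of the tautological line bundle `L^*` of
`ℂP^n`: the pairs `(ℓ, t)` of a line `ℓ` and a vector `t` of the fibre `ℓ^{⊗μ}`. -/
def TautPow (n μ : ℕ) : Type := {p : CP n × TensorAmb n μ // p.2 ∈ fibre μ p.1}

instance (n μ : ℕ) : TopologicalSpace (TautPow n μ) :=
  inferInstanceAs (TopologicalSpace {p : CP n × TensorAmb n μ // p.2 ∈ fibre μ p.1})

namespace TautPow

variable {n μ : ℕ}

/-- The base point. -/
def base (ξ : TautPow n μ) : CP n := ξ.1.1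

/-- The vector in the fibre. -/
def vec (ξ : TautPow n μ) : TensorAmb n μ := ξ.1.2

lemma continuous_base : Continuous (base : TautPow n μ → CP n) :=
  continuous_fst.comp continuous_subtype_val

lemma continuous_vec : Continuous (vec : TautPow n μ → TensorAmb n μ) :=
  continuous_snd.comp continuous_subtype_val

lemma ext {ξ η : TautPow n μ} (h : ξ.base = η.base) (h' : ξ.vec = η.vec) : ξ = η :=
  Subtype.ext (Prod.ext h h')

/-- The point `(ℂ v, λ v^{⊗μ})`. -/
def ofVec (v : Amb n) (hv : v ≠ 0) (c : ℂ) : TautPow n μ :=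
  ⟨(Projectivization.mk ℂ v hv, c • tpow μ v), Submodule.smul_mem _ _ (tpow_mem_fibre μ hv)⟩

@[simp] lemma base_ofVec (v : Amb n) (hv : v ≠ 0) (c : ℂ) :
    (ofVec v hv c : TautPow n μ).base = Projectivization.mk ℂ v hv := rfl

@[simp] lemma vec_ofVec (v : Amb n) (hv : v ≠ 0) (c : ℂ) :
    (ofVec v hv c : TautPow n μ).vec = c • tpow μ v := rfl

lemma continuous_ofVec {α : Type*} [TopologicalSpace α] {f : α → Amb n} (hf : Continuous f)
    (h0 : ∀ a, f a ≠ 0) {g : α → ℂ} (hg : Continuous g) :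
    Continuous fun a => (ofVec (f a) (h0 a) (g a) : TautPow n μ) :=
  ((continuous_mk hf h0).prodMk (hg.smul ((continuous_tpow μ).comp hf))).subtype_mk _

lemma vec_eq {i : Fin (n + 1)} {ξ : TautPow n μ} (h : ξ.base ∈ affineSet i) :
    ξ.vec = ξ.vec (fun _ => i) • tpow μ (affineVec i (affineCoord i ξ.base)) := by
  have h1 : ξ.vec ∈ fibre μ ξ.base := ξ.2
  rw [fibre_eq, rep_eq_smul_affineVec h, tpow_smul] at h1
  obtain ⟨a, ha⟩ := Submodule.mem_span_singleton.1 h1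
  rw [← ha]
  simp [smul_smul]

/-- The trivialization of `L^{*μ}` over `{z_i ≠ 0}` by the frame `v^{⊗μ}`, where `v` is the point
of the line with `i`-th coordinate `1`, as a chart `(ℓ, t) ↦ (affine coordinates of ℓ, c)`,
`t = c v^{⊗μ}`. -/
def chart (i : Fin (n + 1)) : OpenPartialHomeomorph (TautPow n μ) ((Fin n → ℂ) × ℂ) where
  toFun ξ := (affineCoord i ξ.base, ξ.vec fun _ => i)
  invFun p := ofVec (affineVec i p.1) (affineVec_ne_zero i p.1) p.2
  source := {ξ | ξ.base ∈ affineSet i}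
  target := Set.univ
  map_source' _ _ := Set.mem_univ _
  map_target' p _ := by
    simp [mk_mem_affineSet]
  left_inv' ξ h := ext (mk_affineVec h) (vec_eq h).symm
  right_inv' p _ := by
    simp [affineCoord_affineVec]
  open_source := (isOpen_affineSet i).preimage continuous_base
  open_target := isOpen_univ
  continuousOn_toFun :=
    ((continuousOn_affineCoord i).comp continuous_base.continuousOn fun _ h => h).prodMk
      (Continuous.continuousOn (by
        have := continuous_vec (n := n) (μ := μ)
        fun_prop))
  continuousOn_invFun := (continuous_ofVec ((continuous_affineVec i).comp continuous_fst) _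
    continuous_snd).continuousOn

lemma chart_apply (i : Fin (n + 1)) (ξ : TautPow n μ) :
    chart i ξ = (affineCoord i ξ.base, ξ.vec fun _ => i) := rfl

lemma chart_symm_apply (i : Fin (n + 1)) (p : (Fin n → ℂ) × ℂ) :
    (chart i).symm p = (ofVec (affineVec i p.1) (affineVec_ne_zero i p.1) p.2 : TautPow n μ) := rfl

lemma chart_source (i : Fin (n + 1)) :
    (chart i : OpenPartialHomeomorph (TautPow n μ) _).source = {ξ | ξ.base ∈ affineSet i} := rfl

lemma exists_mem_affineSet (ℓ : CP n) : ∃ i, ℓ ∈ affineSet i := by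
  by_contra! h
  refine ℓ.rep_nonzero ?_
  ext i
  have := h i
  simpa [affineSet] using this

instance : ChartedSpace ((Fin n → ℂ) × ℂ) (TautPow n μ) where
  atlas := Set.range chart
  chartAt ξ := chart (exists_mem_affineSet ξ.base).choose
  mem_chart_source ξ := (exists_mem_affineSet ξ.base).choose_spec
  chart_mem_atlas _ := Set.mem_range_self _

/-- `L^{*μ}` is a complex manifold. -/
instance : IsManifold 𝓘(ℂ, (Fin n → ℂ) × ℂ) ω (TautPow n μ) := by
  apply isManifold_of_contDiffOn
  rintro _ _ ⟨i, rfl⟩ ⟨j, rfl⟩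
  have key : ∀ p ∈ ((chart i : OpenPartialHomeomorph (TautPow n μ) _).symm ≫ₕ chart j).source,
      affineVec i p.1 j ≠ 0 := fun p hp => by
    simpa [chart_source, chart_symm_apply, mk_mem_affineSet] using hp.2
  have main : ContDiffOn ℂ ω (fun p : (Fin n → ℂ) × ℂ =>
      ((fun k => affineVec i p.1 (j.succAbove k) / affineVec i p.1 j : Fin n → ℂ),
        p.2 * affineVec i p.1 j ^ μ))
      ((chart i : OpenPartialHomeomorph (TautPow n μ) _).symm ≫ₕ chart j).source := by
    have h1 : ∀ k, ContDiff ℂ ω fun p : (Fin n → ℂ) × ℂ => affineVec i p.1 k :=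
      fun k => (contDiff_affineVec_apply i k).comp contDiff_fst
    refine ContDiffOn.prodMk (contDiffOn_pi.2 fun k => ?_) ?_
    · exact (h1 _).contDiffOn.div (h1 _).contDiffOn key
    · exact (contDiff_snd.mul ((h1 _).pow μ)).contDiffOn
  simp only [modelWithCornersSelf_coe, modelWithCornersSelf_coe_symm, Function.id_comp,
    Function.comp_id, Set.preimage_id, Set.range_id, Set.inter_univ]
  refine main.congr fun p hp => ?_
  simp [chart_apply, chart_symm_apply, affineCoord_mk]

/-- The Hermitian pairing `⟨ξ, η⟩` of two points of `L^{*μ}` (linear in `ξ`, antilinear in `η`)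
induced by the inner product of `ℂ^{n+1}`: it equals `a b̄ ⟨z, w⟩^μ` for `ξ = a z^{⊗μ}`,
`η = b w^{⊗μ}`. Restricted to a fibre, it is the Hermitian metric of `L^{*μ}`. -/
def pairing (ξ η : TautPow n μ) : ℂ := inner ℂ η.vec ξ.vec

/-- The sesquiholomorphic extension `ρ(ξ, η) = ⟨ξ, η⟩ - 1` of the defining function
`‖ξ‖² - 1` of the disc bundle. -/
def rho (ξ η : TautPow n μ) : ℂ := pairing ξ η - 1

end TautPow

/-- The unit disc bundle `D(L^{*μ})`. -/
def discBundle (n μ : ℕ) : Set (TautPow n μ) := {ξ | ‖ξ.vec‖ < 1}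

/-- The closed unit disc bundle. -/
def closedDiscBundle (n μ : ℕ) : Set (TautPow n μ) := {ξ | ‖ξ.vec‖ ≤ 1}

/-! ### The circle bundle as a smooth manifold -/

/-- The unit circle bundle `S(L^{*μ})`. -/
def CircleBundle (n μ : ℕ) : Type := {ξ : TautPow n μ // ‖ξ.vec‖ = 1}

instance (n μ : ℕ) : TopologicalSpace (CircleBundle n μ) :=
  inferInstanceAs (TopologicalSpace {ξ : TautPow n μ // ‖ξ.vec‖ = 1})

instance (n μ : ℕ) : MeasurableSpace (CircleBundle n μ) := borel _

instance (n μ : ℕ) : BorelSpace (CircleBundle n μ) := ⟨rfl⟩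

/-- `c / |c|`. -/
def phase (c : ℂ) : Circle :=
  if h : c = 0 then 1 else ⟨c / ‖c‖, by simp [Submonoid.unitSphere, h]⟩

lemma coe_phase {c : ℂ} (hc : c ≠ 0) : (phase c : ℂ) = c / ‖c‖ := by
  simp [phase, hc]

lemma norm_tpow {n : ℕ} (μ : ℕ) (z : Amb n) : ‖tpow μ z‖ = ‖z‖ ^ μ := by
  have h : ‖tpow μ z‖ ^ 2 = (‖z‖ ^ μ) ^ 2 := by
    rw [← pow_mul, mul_comm μ 2, pow_mul, EuclideanSpace.norm_sq_eq, EuclideanSpace.norm_sq_eq,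
      Fintype.sum_pow]
    simp [Finset.prod_pow]
  exact (pow_left_inj₀ (norm_nonneg _) (by positivity) two_ne_zero).1 h

namespace CircleBundle

variable {n μ : ℕ}

/-- The base point. -/
def base (ξ : CircleBundle n μ) : CP n := ξ.1.base

/-- The vector in the fibre. -/
def vec (ξ : CircleBundle n μ) : TensorAmb n μ := ξ.1.vec

lemma norm_vec (ξ : CircleBundle n μ) : ‖ξ.vec‖ = 1 := ξ.2

lemma continuous_base : Continuous (base : CircleBundle n μ → CP n) :=
  TautPow.continuous_base.comp continuous_subtype_val

lemma continuous_vec : Continuous (vec : CircleBundle n μ → TensorAmb n μ) :=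
  TautPow.continuous_vec.comp continuous_subtype_val

lemma norm_vec_ofVec (v : Amb n) (hv : v ≠ 0) (u : Circle) :
    ‖(TautPow.ofVec v hv (u / (‖v‖ : ℂ) ^ μ) : TautPow n μ).vec‖ = 1 := by
  have : ‖v‖ ≠ 0 := norm_ne_zero_iff.2 hv
  simp [norm_smul, norm_tpow, this, Circle.norm_coe]

/-- The point `(ℂ v, u (v / ‖v‖)^{⊗μ})`. -/
def ofVec (v : Amb n) (hv : v ≠ 0) (u : Circle) : CircleBundle n μ :=
  ⟨TautPow.ofVec v hv (u / (‖v‖ : ℂ) ^ μ), norm_vec_ofVec v hv u⟩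

@[simp] lemma base_ofVec (v : Amb n) (hv : v ≠ 0) (u : Circle) :
    (ofVec v hv u : CircleBundle n μ).base = Projectivization.mk ℂ v hv := rfl

@[simp] lemma vec_ofVec (v : Amb n) (hv : v ≠ 0) (u : Circle) :
    (ofVec v hv u : CircleBundle n μ).vec = ((u : ℂ) / (‖v‖ : ℂ) ^ μ) • tpow μ v := rfl

lemma ext {ξ η : CircleBundle n μ} (h : ξ.base = η.base) (h' : ξ.vec = η.vec) : ξ = η :=
  Subtype.ext (TautPow.ext h h')

lemma continuous_ofVec {α : Type*} [TopologicalSpace α] {f : α → Amb n} (hf : Continuous f)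
    (h0 : ∀ a, f a ≠ 0) {g : α → Circle} (hg : Continuous g) :
    Continuous fun a => (ofVec (f a) (h0 a) (g a) : CircleBundle n μ) := by
  refine Continuous.subtype_mk (TautPow.continuous_ofVec hf h0 ?_) _
  refine (continuous_subtype_val.comp hg).div (by fun_prop) fun a => ?_
  simp [h0 a]

lemma vec_apply_ne_zero {i : Fin (n + 1)} {ξ : CircleBundle n μ} (h : ξ.base ∈ affineSet i) :
    ξ.vec (fun _ => i) ≠ 0 := fun h0 => by
  have h1 := TautPow.vec_eq (ξ := ξ.1) h
  have h2 := ξ.norm_vec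
  change ξ.vec = ξ.vec _ • _ at h1
  rw [h1, h0] at h2
  simp at h2

lemma phase_vec {i : Fin (n + 1)} {ξ : CircleBundle n μ} (h : ξ.base ∈ affineSet i) :
    (phase (ξ.vec fun _ => i) : ℂ) / (‖affineVec i (affineCoord i ξ.base)‖ : ℂ) ^ μ
      = ξ.vec fun _ => i := by
  have h0 := vec_apply_ne_zero h
  have h1 := TautPow.vec_eq (ξ := ξ.1) h
  have h2 := ξ.norm_vec
  change ξ.vec = ξ.vec _ • tpow μ (affineVec i (affineCoord i ξ.base)) at h1
  rw [h1, norm_smul, norm_tpow] at h2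
  rw [coe_phase h0, div_div, ← Complex.ofReal_pow, ← Complex.ofReal_mul, h2]
  simp

lemma continuousOn_phase : ContinuousOn phase {c : ℂ | c ≠ 0} := by
  refine (Topology.IsInducing.subtypeVal (t := {z : ℂ | z ∈ Submonoid.unitSphere ℂ})).continuousOn_iff.2 ?_
  refine ContinuousOn.congr (f := fun c : ℂ => c / ‖c‖) ?_ fun c hc => coe_phase hc
  exact ContinuousOn.div (by fun_prop) (by fun_prop) fun c hc => by simpa using hc

/-- The trivialization of the principal circle bundle `S(L^{*μ})` over `{z_i ≠ 0}`: the unit vector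
`u (v / ‖v‖)^{⊗μ}` over `ℓ`, `v` the point of `ℓ` with `i`-th coordinate `1`, is sent to
(affine coordinates of `ℓ`, `u`). -/
def chart (i : Fin (n + 1)) :
    OpenPartialHomeomorph (CircleBundle n μ) ((Fin n → ℂ) × Circle) where
  toFun ξ := (affineCoord i ξ.base, phase (ξ.vec fun _ => i))
  invFun p := ofVec (affineVec i p.1) (affineVec_ne_zero i p.1) p.2
  source := {ξ | ξ.base ∈ affineSet i}
  target := Set.univ
  map_source' _ _ := Set.mem_univ _
  map_target' p _ := by
    simp [mk_mem_affineSet]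
  left_inv' ξ h := by
    refine ext (mk_affineVec h) ?_
    rw [vec_ofVec, phase_vec h]
    exact (TautPow.vec_eq (ξ := ξ.1) h).symm
  right_inv' p _ := by
    have h1 : (‖affineVec i p.1‖ : ℂ) ≠ 0 := by simp [affineVec_ne_zero]
    refine Prod.ext (by simp [affineCoord_affineVec]) (Circle.ext ?_)
    rw [coe_phase (by simp [affineVec_ne_zero])]
    simp [Circle.norm_coe]
    field_simp
  open_source := (isOpen_affineSet i).preimage continuous_base
  open_target := isOpen_univ
  continuousOn_toFun :=
    ((continuousOn_affineCoord i).comp continuous_base.continuousOn fun _ h => h).prodMk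
      (continuousOn_phase.comp (Continuous.continuousOn (by
        have := continuous_vec (n := n) (μ := μ)
        fun_prop)) fun _ h => vec_apply_ne_zero h)
  continuousOn_invFun := (continuous_ofVec ((continuous_affineVec i).comp continuous_fst) _
    continuous_snd).continuousOn

lemma chart_apply (i : Fin (n + 1)) (ξ : CircleBundle n μ) :
    chart i ξ = (affineCoord i ξ.base, phase (ξ.vec fun _ => i)) := rfl

lemma chart_symm_apply (i : Fin (n + 1)) (p : (Fin n → ℂ) × Circle) :
    (chart i).symm p =
      (ofVec (affineVec i p.1) (affineVec_ne_zero i p.1) p.2 : CircleBundle n μ) := rfl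

lemma chart_source (i : Fin (n + 1)) :
    (chart i : OpenPartialHomeomorph (CircleBundle n μ) _).source = {ξ | ξ.base ∈ affineSet i} :=
  rfl

instance : ChartedSpace ((Fin n → ℂ) × Circle) (CircleBundle n μ) where
  atlas := Set.range chart
  chartAt ξ := chart (TautPow.exists_mem_affineSet ξ.base).choose
  mem_chart_source ξ := (TautPow.exists_mem_affineSet ξ.base).choose_spec
  chart_mem_atlas _ := Set.mem_range_self _

/-- `S(L^{*μ})` is a real manifold of dimension `2n+1`, with charts obtained by composing the local
trivializations with the charts of the circle. -/
instance : ChartedSpace (ModelProd (Fin n → ℂ) (EuclideanSpace ℝ (Fin 1))) (CircleBundle n μ) :=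
  ChartedSpace.comp _ ((Fin n → ℂ) × Circle) _

end CircleBundle

/-- The model of the real manifold `S(L^{*μ})`. -/
abbrev circleModel (n : ℕ) : ModelWithCorners ℝ ((Fin n → ℂ) × EuclideanSpace ℝ (Fin 1))
    (ModelProd (Fin n → ℂ) (EuclideanSpace ℝ (Fin 1))) :=
  𝓘(ℝ, Fin n → ℂ).prod (𝓡 1)

namespace CircleBundle

variable {n μ : ℕ}

lemma contMDiffAt_phase {c : ℂ} (hc : c ≠ 0) : ContMDiffAt 𝓘(ℝ, ℂ) (𝓡 1) ∞ phase c := by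
  have h1 : ContDiffAt ℝ ∞ (fun x : ℂ => (Complex.log (x / c)).im) c := by
    have h2 : ContDiffAt ℂ ∞ (fun x : ℂ => Complex.log (x / c)) c :=
      (Complex.contDiffAt_log (by simp [hc])).comp c (contDiffAt_id.div_const c)
    exact Complex.imCLM.contDiff.contDiffAt.comp c (h2.restrict_scalars ℝ)
  have h3 : ContMDiffAt 𝓘(ℝ, ℂ) (𝓡 1) ∞
      (fun x : ℂ => phase c * Circle.exp (Complex.log (x / c)).im) c :=
    contMDiffAt_const.mul (ContMDiff.contMDiffAt contMDiff_circleExp |>.comp c h1.contMDiffAt)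
  refine h3.congr_of_eventuallyEq ?_
  filter_upwards [isOpen_ne.mem_nhds hc] with x hx
  apply Circle.ext
  have hxc : x / c ≠ 0 := div_ne_zero hx hc
  have h4 := Complex.norm_mul_exp_arg_mul_I (x / c)
  have hx' : (‖x‖ : ℂ) ≠ 0 := by simpa using hx
  have hc' : (‖c‖ : ℂ) ≠ 0 := by simpa using hc
  rw [norm_div, Complex.ofReal_div] at h4
  rw [Circle.coe_mul, Circle.coe_exp, Complex.log_im, coe_phase hx, coe_phase hc]
  generalize Complex.exp ((Complex.arg (x / c)) * Complex.I) = w at *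
  field_simp at h4 ⊢
  rw [← h4]

lemma phase_mul_pow {r : ℝ} (u : Circle) {c : ℂ} (hc : c ≠ 0) (hr : 0 < r) (m : ℕ) :
    phase ((u : ℂ) / (r : ℂ) ^ m * c ^ m) = u * phase c ^ m := by
  apply Circle.ext
  have hr' : (r : ℂ) ≠ 0 := by simpa using hr.ne'
  have hc' : (‖c‖ : ℂ) ≠ 0 := by simpa using hc
  rw [coe_phase (by simp [hc, hr']), Circle.coe_mul, Circle.coe_pow, coe_phase hc]
  simp [Circle.norm_coe, abs_of_pos hr, div_pow]
  field_simp

lemma contMDiffOn_transition (i j : Fin (n + 1)) :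
    ContMDiffOn (circleModel n) (circleModel n) ∞
      ((chart i : OpenPartialHomeomorph (CircleBundle n μ) _).symm ≫ₕ chart j)
      ((chart i : OpenPartialHomeomorph (CircleBundle n μ) _).symm ≫ₕ chart j).source := by
  have key : ∀ p ∈ ((chart i : OpenPartialHomeomorph (CircleBundle n μ) _).symm ≫ₕ chart j).source,
      affineVec i p.1 j ≠ 0 := fun p hp => by
    simpa [chart_source, chart_symm_apply, mk_mem_affineSet] using hp.2
  have h1 : ∀ k, ContDiff ℝ ∞ fun w : Fin n → ℂ => affineVec i w k :=
    fun k => ((contDiff_affineVec_apply i k).restrict_scalars ℝ).of_le (by simp)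
  have h2 : ContMDiffOn (circleModel n) (circleModel n) ∞ (fun p : (Fin n → ℂ) × Circle =>
      ((fun k => affineVec i p.1 (j.succAbove k) / affineVec i p.1 j : Fin n → ℂ),
        p.2 * phase (affineVec i p.1 j) ^ μ))
      ((chart i : OpenPartialHomeomorph (CircleBundle n μ) _).symm ≫ₕ chart j).source := by
    intro p hp
    refine ContMDiffAt.contMDiffWithinAt (ContMDiffAt.prodMk ?_ ?_)
    · have h3 : ContDiffAt ℝ ∞ (fun w : Fin n → ℂ =>
          (fun k => affineVec i w (j.succAbove k) / affineVec i w j : Fin n → ℂ)) p.1 :=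
        contDiffAt_pi.2 fun k => by
          simp only [div_eq_mul_inv]
          exact (h1 _).contDiffAt.mul ((h1 j).contDiffAt.inv (key p hp))
      exact h3.contMDiffAt.comp p contMDiffAt_fst
    · have h4 : ContMDiffAt (circleModel n) (𝓡 1) ∞
          (fun p : (Fin n → ℂ) × Circle => phase (affineVec i p.1 j)) p :=
        (contMDiffAt_phase (key p hp)).comp p
          ((h1 j).contDiffAt.contMDiffAt.comp p contMDiffAt_fst)
      have h5 : ContMDiffAt (𝓡 1) (𝓡 1) ∞ (fun u : Circle => u ^ μ) (phase (affineVec i p.1 j)) :=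
        contMDiff_pow μ _
      exact (contMDiffAt_snd (I := 𝓘(ℝ, Fin n → ℂ)) (J := 𝓡 1)).mul (h5.comp p h4)
  refine h2.congr fun p hp => ?_
  simp only [OpenPartialHomeomorph.coe_trans, Function.comp_apply, chart_symm_apply, chart_apply,
    base_ofVec, affineCoord_mk, vec_ofVec, PiLp.smul_apply, tpow_apply, Finset.prod_const,
    Finset.card_univ, Fintype.card_fin, smul_eq_mul]
  rw [phase_mul_pow _ (key p hp) (norm_pos_iff.2 (affineVec_ne_zero i p.1))]

/-- `S(L^{*μ})` is a smooth manifold. -/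
instance : IsManifold (circleModel n) ∞ (CircleBundle n μ) := by
  apply isManifold_of_contDiffOn
  rintro _ _ ⟨_, ⟨i, rfl⟩, c, hc, rfl⟩ ⟨_, ⟨j, rfl⟩, c', hc', rfl⟩
  rw [← contMDiffOn_iff_contDiffOn]
  intro x hx
  obtain ⟨⟨⟨h1, h1'⟩, h2, h2'⟩, h3⟩ := hx
  have g1 := ((circleModel n).contMDiffOn_symm (n := ∞)) x h3
  have g2 := (contMDiffOn_symm_of_mem_maximalAtlas (I := circleModel n) (n := ∞)
    (IsManifold.subset_maximalAtlas hc)).contMDiffAt (c.open_target.mem_nhds h1)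
  have h4 : c.symm ((circleModel n).symm x) ∈
      ((chart i : OpenPartialHomeomorph (CircleBundle n μ) _).symm ≫ₕ chart j).source := ⟨h1', h2⟩
  have g3 := (contMDiffOn_transition (μ := μ) i j).contMDiffAt
    ((OpenPartialHomeomorph.open_source _).mem_nhds h4)
  have g4 := (contMDiffOn_of_mem_maximalAtlas (I := circleModel n) (n := ∞)
    (IsManifold.subset_maximalAtlas hc')).contMDiffAt (c'.open_source.mem_nhds h2')
  have g5 := (circleModel n).contMDiff (n := ∞)
    (c' (((chart i : OpenPartialHomeomorph (CircleBundle n μ) _).symm ≫ₕ chart j)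
      (c.symm ((circleModel n).symm x))))
  exact (((g5.comp _ g4).comp _ g3).comp _ g2).comp_contMDiffWithinAt x (g1.mono Set.inter_subset_right)

end CircleBundle

/-! ### The sphere and the lens spaces -/

/-- The unit sphere `S^{2n+1}` of `ℂ^{n+1}`. -/
abbrev Sphere (n : ℕ) : Type := sphere (0 : Amb n) 1

instance (n : ℕ) : Fact (Module.finrank ℝ (Amb n) = (2 * n + 1) + 1) := ⟨by
  rw [← Module.finrank_mul_finrank ℝ ℂ, Complex.finrank_real_complex, finrank_euclideanSpace_fin]
  ring⟩

lemma Sphere.ne_zero {n : ℕ} (z : Sphere n) : (z : Amb n) ≠ 0 := ne_zero_of_mem_unit_sphere z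

/-- The group `ℤ_μ` of `μ`-th roots of unity acts on `S^{2n+1}` by scalar multiplication. -/
instance (n μ : ℕ) [NeZero μ] : MulAction (rootsOfUnity μ ℂ) (Sphere n) where
  smul ζ z := ⟨((ζ : ℂˣ) : ℂ) • (z : Amb n), by
    have h : ‖((ζ : ℂˣ) : ℂ)‖ = 1 :=
      Complex.norm_eq_one_of_mem_rootsOfUnity ζ.2
    rw [mem_sphere_zero_iff_norm, norm_smul, h, norm_eq_of_mem_sphere, one_mul]⟩
  one_smul z := Subtype.ext (one_smul ℂ (z : Amb n))
  mul_smul a b z := Subtype.ext (mul_smul ((a : ℂˣ) : ℂ) ((b : ℂˣ) : ℂ) (z : Amb n))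

lemma Sphere.coe_smul {n μ : ℕ} [NeZero μ] (ζ : rootsOfUnity μ ℂ) (z : Sphere n) :
    ((ζ • z : Sphere n) : Amb n) = ((ζ : ℂˣ) : ℂ) • (z : Amb n) := rfl

instance (n μ : ℕ) [NeZero μ] : ContinuousConstSMul (rootsOfUnity μ ℂ) (Sphere n) where
  continuous_const_smul ζ := (continuous_subtype_val.const_smul ((ζ : ℂˣ) : ℂ)).subtype_mk _

instance (n μ : ℕ) [NeZero μ] : IsCancelSMul (rootsOfUnity μ ℂ) (Sphere n) where
  left_cancel' ζ _ _ h := MulAction.injective ζ h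
  right_cancel' a b z h := by
    have h' := congrArg (Subtype.val : Sphere n → Amb n) h
    rw [Sphere.coe_smul, Sphere.coe_smul] at h'
    exact Subtype.ext (Units.ext (smul_left_injective ℂ (Sphere.ne_zero z) h'))

/-- The lens space `S^{2n+1}/ℤ_μ`, with the smooth structure for which the projection from
`S^{2n+1}` is a local diffeomorphism. -/
abbrev LensSpace (n μ : ℕ) [NeZero μ] : Type :=
  MulAction.orbitRel.Quotient (rootsOfUnity μ ℂ) (Sphere n)

/-! ### The Szegő kernel -/

/-- The uniform probability measure on `S^{2n+1}`. -/
def sphereProb (n : ℕ) : Measure (Sphere n) :=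
  ((volume : Measure (Amb n)).toSphere Set.univ)⁻¹ • (volume : Measure (Amb n)).toSphere

/-- The invariant probability measure `π^*(ω^n) ∧ dθ/2π` on `S(L^{*μ})`. Since the normalized
Fubini-Study volume `ω^n` is the image of the uniform measure on `S^{2n+1}`, it is the law of
`e^{iθ} z^{⊗μ}` for independent uniformly distributed `z ∈ S^{2n+1}` and `θ ∈ (0, 2π]`. -/
def circleMeasure (n μ : ℕ) : Measure (CircleBundle n μ) :=
  ((sphereProb n).prod
      ((ENNReal.ofReal (2 * Real.pi))⁻¹ • volume.restrict (Set.Ioc (0 : ℝ) (2 * Real.pi)))).map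
    fun p => CircleBundle.ofVec (p.1 : Amb n) (Sphere.ne_zero p.1) (Circle.exp p.2)

/-- The functions continuous on the closed disc bundle and holomorphic on the open one (the values
outside the closed disc bundle play no role). -/
def diskAlgebra (n μ : ℕ) : Set (TautPow n μ → ℂ) :=
  {f | ContinuousOn f (closedDiscBundle n μ) ∧
    MDifferentiableOn 𝓘(ℂ, (Fin n → ℂ) × ℂ) 𝓘(ℂ, ℂ) f (discBundle n μ)}

/-- The Hardy space `H²(D(L^{*μ}))`: the closure in `L²(S(L^{*μ}), σ)` of the boundary values of
the functions holomorphic on `D(L^{*μ})` and continuous up to the boundary. -/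
def hardySpace (n μ : ℕ) : Submodule ℂ (Lp ℂ 2 (circleMeasure n μ)) :=
  (Submodule.span ℂ {g : Lp ℂ 2 (circleMeasure n μ) | ∃ f ∈ diskAlgebra n μ,
    g =ᵐ[circleMeasure n μ] fun ξ : CircleBundle n μ => f ξ.1}).topologicalClosure

/-- `k` represents the evaluation at `η` on the Hardy space:
`f(η) = ∫_{S(L^{*μ})} f k̄ dσ`. -/
def RepresentsEval (n μ : ℕ) (η : TautPow n μ) (k : Lp ℂ 2 (circleMeasure n μ)) : Prop :=
  k ∈ hardySpace n μ ∧ ∀ f ∈ diskAlgebra n μ,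
    f η = ∫ ξ : CircleBundle n μ, f ξ.1 * conj (k ξ) ∂circleMeasure n μ

/-- `K` is the Szegő kernel of `D(L^{*μ})`, i.e. the reproducing kernel
`K(ξ, η) = k_η(ξ) = ⟨k_η, k_ξ⟩` of the Hardy space, `ξ, η ∈ D(L^{*μ})`, where `k_η` represents the
evaluation at `η`. -/
def IsSzegoKernel (n μ : ℕ) (K : TautPow n μ → TautPow n μ → ℂ) : Prop :=
  ∃ k : TautPow n μ → Lp ℂ 2 (circleMeasure n μ),
    (∀ η ∈ discBundle n μ, RepresentsEval n μ η (k η)) ∧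
    ∀ ξ ∈ discBundle n μ, ∀ η ∈ discBundle n μ, K ξ η = inner ℂ (k ξ) (k η)

/-- The expansion `K = φ (-ρ)^{-(n+1)} + ψ log(-ρ)` of the boundary singularity of `K`, with `φ`, `ψ`
smooth up to the boundary, in a neighbourhood of the diagonal of the boundary `S(L^{*μ})`
(recall that `n + 1 = dim D(L^{*μ})`). -/
def HasBoundaryExpansion (n μ : ℕ) (K : TautPow n μ → TautPow n μ → ℂ)
    (φ ψ : TautPow n μ × TautPow n μ → ℂ) : Prop :=
  ∃ U : Set (TautPow n μ × TautPow n μ), IsOpen U ∧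
    (∀ ξ : CircleBundle n μ, (ξ.1, ξ.1) ∈ U) ∧
    ContMDiffOn (𝓘(ℝ, (Fin n → ℂ) × ℂ).prod 𝓘(ℝ, (Fin n → ℂ) × ℂ)) 𝓘(ℝ, ℂ) ∞ φ U ∧
    ContMDiffOn (𝓘(ℝ, (Fin n → ℂ) × ℂ).prod 𝓘(ℝ, (Fin n → ℂ) × ℂ)) 𝓘(ℝ, ℂ) ∞ ψ U ∧
    ∀ ξ ∈ discBundle n μ, ∀ η ∈ discBundle n μ, (ξ, η) ∈ U →
      K ξ η = φ (ξ, η) / (-TautPow.rho ξ η) ^ (n + 1) +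
        ψ (ξ, η) * Complex.log (-TautPow.rho ξ η)

/-- The logarithmic term of `K` vanishes: `K` has an expansion with `ψ = 0`. -/
def HasNoLogTerm (n μ : ℕ) (K : TautPow n μ → TautPow n μ → ℂ) : Prop :=
  ∃ φ : TautPow n μ × TautPow n μ → ℂ, HasBoundaryExpansion n μ K φ 0

end ProjLineBundle

end

/-! (a) A function holomorphic on `D_μ` splits along the fibres into parts of degree `k`, which are
sections of the `kμ`-th power of the hyperplane bundle, a space of dimension `C(kμ + n, n)`. Unitary
symmetry suggests that the kernel of the degree `k` part is `C(kμ + n, n) ⟨ξ, η⟩^k`. As `C(kμ + n,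
n)` is a polynomial in `k` of degree at most `n`, the series sums to `P(⟨ξ, η⟩) / (1 - ⟨ξ,
η⟩)^{n+1}` with a polynomial `P` (`exists_szegoPoly`). Since `-ρ = 1 - ⟨ξ, η⟩`, the numerator is
smooth everywhere and no logarithm is needed.

The reproducing property is checked directly, without decomposing the Hardy space. For `η` over the
line of a unit vector `w`, averaging `f` over the rotations fixing `w` is a mean value over a
holomorphic disc centred on the fibre of `w` (`average_ofSphere_slice`). What remains is a power
series in one variable and the moments `∫ |⟨z, w⟩|^{2m} = 1 / C(m + n, n)` of the sphere
(`integral_inner_pow`), obtained by comparing a Gaussian integral in Cartesian and polar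
coordinates. The discs stay in the open bundle only for the dilates `f(s ·)`, `s < 1`, so one lets
`s → 1` at the end (`eq_integral_mul_conj_szegoFun`). Uniqueness of representing elements turns this
formula into a statement about every Szegő kernel.

(b) The fibres of `z ↦ (ℂ z, z^{⊗μ})` are the orbits of the `μ`-th roots of unity, and a local
branch of the `μ`-th root on the circle gives smooth local sections (`exists_local_section`). Hence
the induced bijection is smooth in both directions.

(c) A homeomorphism of the circle bundle with the sphere would make `S^{2n+1} → S^{2n+1}/ℤ_μ` a
connected covering of a sphere of dimension at least 3. Such a covering is injective
(`injective_of_isCoveringMap_sphere`), whereas its fibres have `μ > 1` points. -/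

noncomputable section

namespace ProjLineBundle

/-! ### The generating function of the dimensions `C(kμ + n, n)` -/

/-- The sequences spanned by `k ↦ C(k + j, j)`, `j ≤ m`. -/
def chooseSpan (m : ℕ) : Submodule ℂ (ℕ → ℂ) :=
  Submodule.span ℂ ((fun j k => (((k + j).choose j : ℕ) : ℂ)) '' Set.Iic m)

lemma choose_mem_chooseSpan {j m : ℕ} (h : j ≤ m) :
    (fun k => (((k + j).choose j : ℕ) : ℂ)) ∈ chooseSpan m :=
  Submodule.subset_span ⟨j, h, rfl⟩

/-- The identity `(k + j + 1) C(k + j, j) = (j + 1) C(k + j + 1, j + 1)` trades a factor `k` for one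
more step in `j`. -/
lemma affine_mul_mem_chooseSpan (a b : ℂ) {m : ℕ} {c : ℕ → ℂ} (hc : c ∈ chooseSpan m) :
    (fun k => (a * k + b) * c k) ∈ chooseSpan (m + 1) := by
  induction hc using Submodule.span_induction with
  | mem x hx =>
    obtain ⟨j, hj, rfl⟩ := hx
    have h1 := choose_mem_chooseSpan (Nat.succ_le_succ hj)
    have h2 := choose_mem_chooseSpan (Nat.le_succ_of_le hj)
    -- The coefficients come from `a k + b = a (k + j + 1) + (b - a (j + 1))`.
    convert! add_mem (Submodule.smul_mem _ (a * (j + 1)) h1)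
      (Submodule.smul_mem _ (b - a * (j + 1)) h2) using 1
    funext k
    have h3 := Nat.add_one_mul_choose_eq (k + j) j
    have h4 : ((k : ℂ) + j + 1) * ((k + j).choose j : ℕ)
        = ((k + j + 1).choose (j + 1) : ℕ) * (j + 1) := by exact_mod_cast h3
    simp only [Pi.add_apply, Pi.smul_apply, smul_eq_mul]
    rw [← add_assoc k j 1]
    linear_combination a * h4
  | zero =>
    convert! (chooseSpan (m + 1)).zero_mem using 1
    simp [Pi.zero_def]
  | add x y _ _ hx hy =>
    convert! add_mem hx hy using 1
    funext k
    simp [mul_add]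
  | smul r x _ hx =>
    convert! Submodule.smul_mem _ r hx using 1
    funext k
    simp [mul_left_comm]

/-- Passing from `n` to `n + 1` multiplies the sequence by `(μ k + n + 1) / (n + 1)`, which is
affine in `k`. -/
lemma choose_mul_add_mem_chooseSpan (n μ : ℕ) :
    (fun k => (((k * μ + n).choose n : ℕ) : ℂ)) ∈ chooseSpan n := by
  induction n with
  | zero => simpa using choose_mem_chooseSpan (le_refl 0)
  | succ n ih =>
    convert! Submodule.smul_mem _ ((n + 1 : ℂ)⁻¹)
      (affine_mul_mem_chooseSpan (μ : ℂ) (n + 1 : ℂ) ih) using 1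
    funext k
    have h3 := Nat.add_one_mul_choose_eq (k * μ + n) n
    have h4 : ((k : ℂ) * μ + n + 1) * ((k * μ + n).choose n : ℕ)
        = ((k * μ + n + 1).choose (n + 1) : ℕ) * (n + 1) := by exact_mod_cast h3
    have h5 : (n + 1 : ℂ) ≠ 0 := by exact_mod_cast n.succ_ne_zero
    simp only [Pi.smul_apply, smul_eq_mul]
    rw [← add_assoc (k * μ) n 1]
    field_simp
    linear_combination -h4

lemma exists_polynomial_hasSum {m : ℕ} {c : ℕ → ℂ} (hc : c ∈ chooseSpan m) :
    ∃ P : Polynomial ℂ, ∀ t : ℂ, ‖t‖ < 1 →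
      HasSum (fun k => c k * t ^ k) (P.eval t / (1 - t) ^ (m + 1)) := by
  induction hc using Submodule.span_induction with
  | mem x hx =>
    obtain ⟨j, hj, rfl⟩ := hx
    -- `∑ C(k + j, j) t^k = (1 - t)^{-(j+1)}`, brought to the common denominator `(1 - t)^{m+1}`.
    refine ⟨(1 - Polynomial.X) ^ (m - j), fun t ht => ?_⟩
    have h1 : 1 - t ≠ 0 := by
      rintro h
      rw [← sub_eq_zero.1 h] at ht
      simp at ht
    convert! hasSum_choose_mul_geometric_of_norm_lt_one j ht using 1
    obtain ⟨d, rfl⟩ := Nat.exists_eq_add_of_le (Set.mem_Iic.1 hj)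
    rw [show j + d + 1 = d + (j + 1) by ring, pow_add]
    simp
    field_simp
  | zero => exact ⟨0, fun t _ => by simp [hasSum_zero]⟩
  | add x y _ _ hx hy =>
    obtain ⟨P, hP⟩ := hx
    obtain ⟨Q, hQ⟩ := hy
    refine ⟨P + Q, fun t ht => ?_⟩
    simpa [add_mul, add_div] using (hP t ht).add (hQ t ht)
  | smul r x _ hx =>
    obtain ⟨P, hP⟩ := hx
    refine ⟨Polynomial.C r * P, fun t ht => ?_⟩
    simpa [mul_assoc, mul_div_assoc] using (hP t ht).mul_left r

lemma exists_szegoPoly (n μ : ℕ) : ∃ P : Polynomial ℂ, ∀ t : ℂ, ‖t‖ < 1 →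
    HasSum (fun k => (((k * μ + n).choose n : ℕ) : ℂ) * t ^ k) (P.eval t / (1 - t) ^ (n + 1)) :=
  exists_polynomial_hasSum (choose_mul_add_mem_chooseSpan n μ)

/-- The numerator of the generating function `∑ C(kμ + n, n) t^k = P(t) / (1 - t)^{n+1}`. -/
def szegoPoly (n μ : ℕ) : Polynomial ℂ := (exists_szegoPoly n μ).choose

lemma hasSum_szegoPoly (n μ : ℕ) {t : ℂ} (ht : ‖t‖ < 1) :
    HasSum (fun k => (((k * μ + n).choose n : ℕ) : ℂ) * t ^ k)
      ((szegoPoly n μ).eval t / (1 - t) ^ (n + 1)) :=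
  (exists_szegoPoly n μ).choose_spec t ht

/-! ### Holomorphic and smooth maps on the line bundles -/

lemma contDiff_affineVec {n : ℕ} (i : Fin (n + 1)) :
    ContDiff ℂ ω (affineVec i : (Fin n → ℂ) → Amb n) :=
  (contDiff_piLp 2).2 fun k => contDiff_affineVec_apply i k

lemma contDiff_tpow {n : ℕ} (μ : ℕ) : ContDiff ℂ ω (tpow μ : Amb n → TensorAmb n μ) := by
  refine (contDiff_piLp 2).2 fun I => ?_
  simp only [tpow_apply]
  exact contDiff_prod fun k _ => contDiff_piLp_apply 2

lemma inner_tpow {n : ℕ} (μ : ℕ) (w z : Amb n) :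
    inner ℂ (tpow μ w) (tpow μ z) = inner ℂ w z ^ μ := by
  simp only [PiLp.inner_apply, tpow_apply, RCLike.inner_apply, map_prod, ← Finset.prod_mul_distrib]
  rw [Fintype.sum_pow]

namespace TautPow

variable {n μ : ℕ}

lemma contDiff_vec_chart_symm (i : Fin (n + 1)) :
    ContDiff ℂ ω fun p => ((chart i).symm p : TautPow n μ).vec := by
  simp only [chart_symm_apply, vec_ofVec]
  exact contDiff_snd.smul ((contDiff_tpow μ).comp ((contDiff_affineVec i).comp contDiff_fst))

lemma contMDiff_vec :
    ContMDiff 𝓘(ℂ, (Fin n → ℂ) × ℂ) 𝓘(ℂ, TensorAmb n μ) ω (vec : TautPow n μ → _) := fun _ =>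
  contMDiffAt_iff.2 ⟨continuous_vec.continuousAt, (contDiff_vec_chart_symm _).contDiffWithinAt⟩

lemma contMDiff_real_vec :
    ContMDiff 𝓘(ℝ, (Fin n → ℂ) × ℂ) 𝓘(ℝ, TensorAmb n μ) ∞ (vec : TautPow n μ → _) := fun _ =>
  contMDiffAt_iff.2 ⟨continuous_vec.continuousAt,
    (((contDiff_vec_chart_symm _).restrict_scalars ℝ).of_le (by simp)).contDiffWithinAt⟩

/-- In the chart where `v_i ≠ 0` the curve reads `(v_j / v_i, c v_i^μ)`. This lets functions of the
disc algebra be restricted to holomorphic discs. -/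
lemma mdifferentiableAt_ofVec {v : ℂ → Amb n} (hv : ∀ x, v x ≠ 0) {c : ℂ → ℂ} {x : ℂ}
    (h1 : Differentiable ℂ v) (h2 : Differentiable ℂ c) :
    MDifferentiableAt 𝓘(ℂ, ℂ) 𝓘(ℂ, (Fin n → ℂ) × ℂ)
      (fun x => (ofVec (v x) (hv x) (c x) : TautPow n μ)) x := by
  refine (mdifferentiableAt_iff _ _).2
    ⟨(continuous_ofVec h1.continuous hv h2.continuous).continuousAt, ?_⟩
  obtain ⟨i, hi, hc⟩ : ∃ i, Projectivization.mk ℂ (v x) (hv x) ∈ affineSet i ∧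
      chartAt ((Fin n → ℂ) × ℂ) (ofVec (v x) (hv x) (c x) : TautPow n μ) = chart i :=
    ⟨_, (exists_mem_affineSet _).choose_spec, rfl⟩
  rw [mk_mem_affineSet] at hi
  have h3 : ∀ k, DifferentiableAt ℂ (fun y => v y k) x := fun k =>
    (differentiableAt_piLp 2).1 h1.differentiableAt k
  have key : DifferentiableAt ℂ (fun y => ((fun j => v y (i.succAbove j) / v y i : Fin n → ℂ),
      c y * v y i ^ μ)) x :=
    (differentiableAt_pi.2 fun j => (h3 _).div (h3 _) hi).prodMk
      (h2.differentiableAt.mul ((h3 i).pow μ))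
  refine DifferentiableAt.differentiableWithinAt ?_
  convert! key using 1
  funext y
  simp only [writtenInExtChartAt, extChartAt, hc, mfld_simps, chart_apply, base_ofVec,
    affineCoord_mk]
  simp only [vec_ofVec, PiLp.smul_apply, tpow_apply, Finset.prod_const, Finset.card_univ,
    Fintype.card_fin,
    smul_eq_mul]
  rfl

lemma pairing_ofVec (z w : Amb n) (hz : z ≠ 0) (hw : w ≠ 0) (a b : ℂ) :
    pairing (ofVec z hz a : TautPow n μ) (ofVec w hw b) = a * conj b * inner ℂ w z ^ μ := by
  simp [pairing, inner_tpow]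
  ring

lemma norm_pairing_le (ξ η : TautPow n μ) : ‖pairing ξ η‖ ≤ ‖ξ.vec‖ * ‖η.vec‖ := by
  rw [mul_comm]
  exact norm_inner_le_norm _ _

/-- Every point of the line bundle is of the form `(ℂ w, r w^{⊗μ})` with a unit vector `w`. -/
lemma exists_eq_ofVec (η : TautPow n μ) :
    ∃ (w : Sphere n) (r : ℂ), η = ofVec (w : Amb n) w.ne_zero r ∧ ‖η.vec‖ = ‖r‖ := by
  have h0 := η.base.rep_nonzero
  have h0' : ‖η.base.rep‖ ≠ 0 := norm_ne_zero_iff.2 h0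
  have hv : η.vec ∈ fibre μ η.base := η.2
  rw [fibre_eq] at hv
  obtain ⟨a, ha⟩ := Submodule.mem_span_singleton.1 hv
  let w : Sphere n := ⟨((‖η.base.rep‖ : ℂ)⁻¹) • η.base.rep, by
    rw [mem_sphere_zero_iff_norm, norm_smul]
    simp [h0']⟩
  have hw : (‖η.base.rep‖ : ℂ) • (w : Amb n) = η.base.rep := by
    rw [smul_inv_smul₀]
    simpa using h0
  have hvec : η.vec = (a * ‖η.base.rep‖ ^ μ) • tpow μ (w : Amb n) := by
    rw [mul_smul, ← tpow_smul, hw, ha]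
  refine ⟨w, a * ‖η.base.rep‖ ^ μ, ext ?_ hvec, ?_⟩
  · rw [base_ofVec]
    conv_lhs => rw [← η.base.mk_rep]
    rw [Projectivization.mk_eq_mk_iff']
    exact ⟨_, hw⟩
  · rw [hvec, norm_smul, norm_tpow, norm_eq_of_mem_sphere w]
    simp

lemma norm_vec_ofVec (z : Sphere n) (c : ℂ) :
    ‖(ofVec (z : Amb n) z.ne_zero c : TautPow n μ).vec‖ = ‖c‖ := by
  simp [norm_smul, norm_tpow, norm_eq_of_mem_sphere z]

end TautPow

/-- It is the image of the sphere times the closed disc under `(z, c) ↦ c z^{⊗μ}`. Compactness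
provides the bounds used for integrability and dominated convergence. -/
lemma isCompact_closedDiscBundle (n μ : ℕ) : IsCompact (closedDiscBundle n μ) := by
  have h1 : IsCompact ((Set.univ : Set (Sphere n)) ×ˢ closedBall (0 : ℂ) 1) :=
    isCompact_univ.prod (isCompact_closedBall 0 1)
  have h2 : Continuous fun p : Sphere n × ℂ =>
      (TautPow.ofVec (p.1 : Amb n) p.1.ne_zero p.2 : TautPow n μ) :=
    TautPow.continuous_ofVec (continuous_subtype_val.comp continuous_fst) _ continuous_snd
  convert! h1.image h2 using 1
  ext ξ
  simp only [closedDiscBundle, Set.mem_ofPred_eq, Set.mem_image, Set.mem_prod, Set.mem_univ,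
    true_and,
    mem_closedBall_zero_iff]
  constructor
  · intro h
    obtain ⟨w, r, h3, h4⟩ := ξ.exists_eq_ofVec
    exact ⟨(w, r), h4 ▸ h, h3.symm⟩
  · rintro ⟨p, hp, rfl⟩
    rwa [TautPow.norm_vec_ofVec]

lemma isOpen_discBundle (n μ : ℕ) : IsOpen (discBundle n μ) :=
  isOpen_lt TautPow.continuous_vec.norm continuous_const

/-! ### The uniform measure on the sphere -/

lemma isProbabilityMeasure_sphereProb (n : ℕ) : IsProbabilityMeasure (sphereProb n) := by
  refine ⟨?_⟩
  rw [sphereProb, Measure.smul_apply, smul_eq_mul]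
  refine ENNReal.inv_mul_cancel ?_ (measure_ne_top _ _)
  rw [Ne, Measure.measure_univ_eq_zero]
  exact Measure.toSphere_ne_zero _

attribute [instance] isProbabilityMeasure_sphereProb

/-- The restriction of a linear isometry of `ℂ^{n+1}` to the sphere. -/
def sphereMap {n : ℕ} (U : Amb n ≃ₗᵢ[ℂ] Amb n) (z : Sphere n) : Sphere n :=
  ⟨U z, by simp [norm_eq_of_mem_sphere z]⟩

lemma continuous_sphereMap {n : ℕ} (U : Amb n ≃ₗᵢ[ℂ] Amb n) : Continuous (sphereMap U) :=
  (U.continuous.comp continuous_subtype_val).subtype_mk _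

lemma measurePreserving_isometry {n : ℕ} (U : Amb n ≃ₗᵢ[ℂ] Amb n) :
    MeasurePreserving U (volume : Measure (Amb n)) volume :=
  LinearIsometryEquiv.measurePreserving (E := Amb n) (F := Amb n)
    { U.toLinearEquiv.restrictScalars ℝ with norm_map' := U.norm_map }

-- The surface measure of a set is, up to a constant, the volume of the cone over it, and a unitary
-- map carries cones to cones and preserves volume.
open scoped Pointwise in
lemma measurePreserving_sphereMap {n : ℕ} (U : Amb n ≃ₗᵢ[ℂ] Amb n) :
    MeasurePreserving (sphereMap U) (sphereProb n) (sphereProb n) := by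
  refine MeasurePreserving.smul_measure ⟨(continuous_sphereMap U).measurable, ?_⟩ _
  ext s hs
  have hs' := (continuous_sphereMap U).measurable hs
  rw [Measure.map_apply (continuous_sphereMap U).measurable hs, Measure.toSphere_apply' _ hs',
    Measure.toSphere_apply' _ hs]
  congr 1
  refine Eq.trans ?_ ((measurePreserving_isometry U).measure_preimage_emb
    U.toHomeomorph.measurableEmbedding _)
  congr 1
  ext x
  simp only [Set.mem_preimage, Set.mem_smul, Set.mem_image, exists_exists_and_eq_and]
  constructor
  · rintro ⟨r, hr, z, hz, rfl⟩
    refine ⟨r, hr, sphereMap U z, hz, ?_⟩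
    exact (U.toLinearEquiv.toLinearMap.map_smul_of_tower r _).symm
  · rintro ⟨r, hr, z, hz, h⟩
    refine ⟨r, hr, sphereMap U.symm z, ?_, ?_⟩
    · convert hz
      simp [sphereMap]
    · apply U.injective
      refine (U.toLinearEquiv.toLinearMap.map_smul_of_tower r _).trans (Eq.trans ?_ h)
      simp [sphereMap]

-- The cone over the exceptional set lies in the orthogonal complement of `w`, a proper real
-- subspace, hence null. Discarding it keeps the discs `slice w z` away from the zero vector.
open scoped Pointwise in
lemma sphereProb_inner_eq_zero {n : ℕ} (w : Sphere n) :
    ∀ᵐ z : Sphere n ∂sphereProb n, inner ℂ (w : Amb n) (z : Amb n) ≠ 0 := by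
  refine Measure.ae_smul_measure ?_ _
  have hm : MeasurableSet {z : Sphere n | inner ℂ (w : Amb n) (z : Amb n) = 0} :=
    (isClosed_eq (by fun_prop) continuous_const).measurableSet
  rw [ae_iff]
  simp only [ne_eq, not_not]
  rw [Measure.toSphere_apply' _ hm]
  let H : Submodule ℝ (Amb n) := ((ℂ ∙ (w : Amb n))ᗮ).restrictScalars ℝ
  have hH : H ≠ ⊤ := by
    intro h
    have h1 : (w : Amb n) ∈ H := h ▸ Submodule.mem_top
    have h2 := (Submodule.mem_orthogonal_singleton_iff_inner_right.1 h1)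
    exact w.ne_zero (inner_self_eq_zero.1 h2)
  have h3 : (Set.Ioo (0 : ℝ) 1 •
      (Subtype.val '' {z : Sphere n | inner ℂ (w : Amb n) (z : Amb n) = 0}))
      ⊆ (H : Set (Amb n)) := by
    rintro _ ⟨r, -, _, ⟨z, hz, rfl⟩, rfl⟩
    exact H.smul_mem r (Submodule.mem_orthogonal_singleton_iff_inner_right.2 hz)
  rw [measure_mono_null h3 (Measure.addHaar_submodule _ H hH), mul_zero]

lemma exists_isometry_apply_zero {n : ℕ} (w : Sphere n) :
    ∃ U : Amb n ≃ₗᵢ[ℂ] Amb n, ∀ x, U x 0 = inner ℂ (w : Amb n) x := by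
  have h1 : Orthonormal ℂ (({0} : Set (Fin (n + 1))).domRestrict fun _ => (w : Amb n)) := by
    refine ⟨fun i => norm_eq_of_mem_sphere w, fun i j h => (h (Subsingleton.elim _ _)).elim⟩
  obtain ⟨b, hb⟩ := h1.exists_orthonormalBasis_extension_of_card_eq (by simp)
  refine ⟨b.repr, fun x => ?_⟩
  rw [b.repr_apply_apply, hb 0 rfl]

/-! ### Moments of the sphere from Gaussian integrals -/

lemma integral_exp_mul_norm_pow (m : ℕ) :
    ∫ x : ℂ, ‖x‖ ^ (2 * m) * Real.exp (-‖x‖ ^ 2) = Real.pi * m.factorial := by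
  have h := Complex.integral_rpow_mul_exp_neg_rpow (p := 2) (q := (2 * m : ℕ)) one_le_two
    (by have : (0 : ℝ) ≤ (2 * m : ℕ) := by positivity
        linarith)
  simp only [Real.rpow_natCast, Real.rpow_ofNat] at h
  rw [h, show (((2 * m : ℕ) : ℝ) + 2) / 2 = m + 1 by push_cast; ring, Real.Gamma_nat_eq_factorial]
  ring

/-- A unitary map takes `⟨w, x⟩` to the first coordinate, after which the Gaussian splits into
one-variable integrals: `π m!` for that coordinate and `π` for each other one. The normalization of
the volume is left in `κ`, since only ratios of moments matter. -/
lemma exists_integral_gaussian (n : ℕ) : ∃ κ : ℝ, ∀ (w : Sphere n) (m : ℕ),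
    ∫ x : Amb n, ‖inner ℂ (w : Amb n) x‖ ^ (2 * m) * Real.exp (-‖x‖ ^ 2) = κ * m.factorial := by
  let e : Amb n ≃L[ℝ] (Fin (n + 1) → ℂ) := PiLp.continuousLinearEquiv 2 ℝ fun _ => ℂ
  let ν : Measure (Fin (n + 1) → ℂ) := (volume : Measure (Amb n)).map e
  -- Uniqueness of Haar measure compares the Euclidean volume with the product volume.
  obtain ⟨κ, hν⟩ : ∃ κ : NNReal, ν = κ • volume := ⟨_, Measure.isAddLeftInvariant_eq_smul ν volume⟩
  refine ⟨κ * Real.pi ^ (n + 1), fun w m => ?_⟩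
  obtain ⟨U, hU⟩ := exists_isometry_apply_zero w
  have h1 : ∫ x : Amb n, ‖inner ℂ (w : Amb n) x‖ ^ (2 * m) * Real.exp (-‖x‖ ^ 2)
      = ∫ x : Amb n, ‖x 0‖ ^ (2 * m) * Real.exp (-‖x‖ ^ 2) := by
    rw [← (measurePreserving_isometry U).integral_comp U.toHomeomorph.measurableEmbedding
      fun x => ‖x 0‖ ^ (2 * m) * Real.exp (-‖x‖ ^ 2)]
    simp [hU]
  have h2 : ∫ x : Amb n, ‖x 0‖ ^ (2 * m) * Real.exp (-‖x‖ ^ 2)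
      = ∫ y, ‖y 0‖ ^ (2 * m) * Real.exp (-∑ i, ‖y i‖ ^ 2) ∂ν := by
    refine Eq.trans ?_ (e.toHomeomorph.measurableEmbedding.integral_map _).symm
    congr 1
    funext x
    rw [EuclideanSpace.norm_sq_eq]
    rfl
  have h3 : ∀ y : Fin (n + 1) → ℂ, ‖y 0‖ ^ (2 * m) * Real.exp (-∑ i, ‖y i‖ ^ 2)
      = ∏ i, ‖y i‖ ^ (2 * (if i = 0 then m else 0)) * Real.exp (-‖y i‖ ^ 2) := by
    intro y
    rw [Finset.prod_mul_distrib, ← Real.exp_sum, Finset.sum_neg_distrib]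
    congr 1
    rw [Fin.prod_univ_succ]
    simp
  rw [h1, h2, hν, integral_smul_nnreal_measure]
  simp_rw [h3]
  rw [integral_fintype_prod_volume_eq_prod (fun i (z : ℂ) =>
    ‖z‖ ^ (2 * (if i = 0 then m else 0)) * Real.exp (-‖z‖ ^ 2))]
  simp_rw [integral_exp_mul_norm_pow]
  rw [Fin.prod_univ_succ]
  simp [NNReal.smul_def, pow_succ]
  ring

lemma integral_volumeIoiPow (n m : ℕ) :
    ∫ r : Set.Ioi (0 : ℝ), (r : ℝ) ^ (2 * m) * Real.exp (-(r : ℝ) ^ 2)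
      ∂Measure.volumeIoiPow (2 * n + 1) = (m + n).factorial / 2 := by
  have h := integral_rpow_mul_exp_neg_rpow (p := 2) (q := (2 * (m + n) + 1 : ℕ)) two_pos
    (by have : (0 : ℝ) ≤ (2 * (m + n) + 1 : ℕ) := by positivity
        linarith)
  simp only [Real.rpow_natCast, Real.rpow_ofNat] at h
  rw [show (((2 * (m + n) + 1 : ℕ) : ℝ) + 1) / 2 = (m + n : ℕ) + 1 by push_cast; ring,
    Real.Gamma_nat_eq_factorial] at h
  rw [Measure.volumeIoiPow]
  have h1 : Measurable fun r : Set.Ioi (0 : ℝ) => ((r : ℝ) ^ (2 * n + 1)).toNNReal := by fun_prop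
  erw [integral_withDensity_eq_integral_smul h1]
  rw [integral_subtype_comap measurableSet_Ioi
    (fun r : ℝ => (r ^ (2 * n + 1)).toNNReal • (r ^ (2 * m) * Real.exp (-r ^ 2)))]
  rw [div_eq_inv_mul, ← one_div, ← h]
  refine setIntegral_congr_fun measurableSet_Ioi fun r hr => ?_
  have hr' : 0 ≤ r ^ (2 * n + 1) := pow_nonneg (le_of_lt hr) _
  simp only [NNReal.smul_def, Real.coe_toNNReal _ hr', smul_eq_mul]
  ring

/-- Polar coordinates: `|⟨w, x⟩|^{2m}` is homogeneous of degree `2m`, so the integral is the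
spherical moment times the radial integral `∫ r^{2m + 2n + 1} e^{-r²} dr`. -/
lemma integral_gaussian_eq {n : ℕ} (w : Sphere n) (m : ℕ) :
    ∫ x : Amb n, ‖inner ℂ (w : Amb n) x‖ ^ (2 * m) * Real.exp (-‖x‖ ^ 2)
      = (∫ z : Sphere n, ‖inner ℂ (w : Amb n) (z : Amb n)‖ ^ (2 * m)
          ∂(volume : Measure (Amb n)).toSphere) * ((m + n).factorial / 2) := by
  have hd : Module.finrank ℝ (Amb n) - 1 = 2 * n + 1 := by
    rw [Fact.out (p := Module.finrank ℝ (Amb n) = (2 * n + 1) + 1)]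
    rfl
  have hp := (volume : Measure (Amb n)).measurePreserving_homeomorphUnitSphereProd
  rw [hd] at hp
  rw [← integral_volumeIoiPow, ← integral_prod_mul,
    ← hp.integral_comp (Homeomorph.measurableEmbedding _)]
  have h0 : ∫ x : Amb n, ‖inner ℂ (w : Amb n) x‖ ^ (2 * m) * Real.exp (-‖x‖ ^ 2)
      = ∫ x in ({0}ᶜ : Set (Amb n)), ‖inner ℂ (w : Amb n) x‖ ^ (2 * m) * Real.exp (-‖x‖ ^ 2) := by
    rw [restrict_compl_singleton]
  rw [h0, ← integral_subtype_comap (measurableSet_singleton _).compl]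
  congr 1
  funext x
  have hx : ‖(x : Amb n)‖ ≠ 0 := norm_ne_zero_iff.2 x.2
  have h1 : (x : Amb n) = (‖(x : Amb n)‖ : ℂ) •
      ((homeomorphUnitSphereProd (Amb n) x).1 : Amb n) := by
    ext k
    have hx' : (‖(x : Amb n)‖ : ℂ) ≠ 0 := by simpa using hx
    simp [homeomorphUnitSphereProd]
    field_simp
  have h2 : ((homeomorphUnitSphereProd (Amb n) x).2 : ℝ) = ‖(x : Amb n)‖ := by simp
  rw [h2]
  conv_lhs => rw [h1, inner_smul_right]
  rw [norm_mul, mul_pow, norm_smul, norm_eq_of_mem_sphere]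
  simp only [Complex.norm_real, norm_norm, mul_one]
  ring

/-- The moments of the coordinate `⟨z, w⟩` of a uniformly distributed point of the sphere. -/
lemma integral_inner_pow {n : ℕ} (w : Sphere n) (m : ℕ) :
    ∫ z : Sphere n, ‖inner ℂ (w : Amb n) (z : Amb n)‖ ^ (2 * m) ∂sphereProb n
      = (((m + n).choose n : ℕ) : ℝ)⁻¹ := by
  obtain ⟨κ, hκ⟩ := exists_integral_gaussian n
  have h1 := (integral_gaussian_eq w m).symm.trans (hκ w m)
  -- The case `m = 0` expresses `κ` through the total mass of the sphere, so that both unknown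
  -- constants cancel below.
  have h0 := (integral_gaussian_eq w 0).symm.trans (hκ w 0)
  simp only [mul_zero, pow_zero, integral_const, smul_eq_mul, mul_one, zero_add, Nat.factorial_zero,
    Nat.cast_one] at h0
  have hpos : (volume : Measure (Amb n)).toSphere.real Set.univ ≠ 0 := by
    rw [measureReal_def, ENNReal.toReal_ne_zero]
    exact ⟨by rw [Ne, Measure.measure_univ_eq_zero]; exact Measure.toSphere_ne_zero _,
      measure_ne_top _ _⟩
  rw [sphereProb, integral_smul_measure, ENNReal.toReal_inv, ← measureReal_def, smul_eq_mul]
  have h2 : (((m + n).choose n : ℕ) : ℝ) * (m.factorial * n.factorial) = (m + n).factorial := by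
    rw [mul_comm (m.factorial : ℝ), ← mul_assoc]
    exact_mod_cast by
      have := Nat.add_choose_mul_factorial_mul_factorial m n
      linarith
  have h3 : (((m + n).choose n : ℕ) : ℝ) ≠ 0 := by
    exact_mod_cast (Nat.choose_pos (Nat.le_add_left n m)).ne'
  have h4 : (m.factorial : ℝ) ≠ 0 := by exact_mod_cast m.factorial_ne_zero
  have h5 : (n.factorial : ℝ) ≠ 0 := by exact_mod_cast n.factorial_ne_zero
  rw [← h0, ← h2] at h1
  field_simp at h1 ⊢
  linarith

/-! ### The reproducing property -/

/-- The uniform probability measure on `(0, 2π]`. -/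
def angleProb : Measure ℝ :=
  (ENNReal.ofReal (2 * Real.pi))⁻¹ • volume.restrict (Set.Ioc (0 : ℝ) (2 * Real.pi))

instance : IsProbabilityMeasure angleProb := by
  refine ⟨?_⟩
  rw [angleProb, Measure.smul_apply, Measure.restrict_apply_univ, Real.volume_Ioc, sub_zero,
    smul_eq_mul]
  exact ENNReal.inv_mul_cancel (by simp [Real.pi_pos]) ENNReal.ofReal_ne_top

lemma integral_angleProb (f : ℂ → ℂ) :
    ∫ θ, f (Circle.exp θ) ∂angleProb = Real.circleAverage f 0 1 := by
  rw [angleProb, integral_smul_measure, Real.circleAverage_def,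
    intervalIntegral.integral_of_le Real.two_pi_pos.le, ENNReal.toReal_inv,
    ENNReal.toReal_ofReal Real.two_pi_pos.le]
  simp [circleMap]

lemma integral_angleProb_pow (m : ℕ) :
    ∫ θ, ((Circle.exp θ : ℂ)) ^ m ∂angleProb = if m = 0 then 1 else 0 := by
  rw [integral_angleProb fun z => z ^ m]
  have h : DiffContOnCl ℂ (fun z : ℂ => z ^ m) (ball 0 |1|) :=
    (differentiable_pow m).diffContOnCl
  rw [h.circleAverage]
  simp [zero_pow_eq]

lemma integral_angleProb_pow_mul_conj_pow (j k : ℕ) :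
    ∫ θ, ((Circle.exp θ : ℂ)) ^ j * conj (Circle.exp θ : ℂ) ^ k ∂angleProb
      = if j = k then 1 else 0 := by
  have h1 : ∀ θ, (Circle.exp θ : ℂ) * conj (Circle.exp θ : ℂ) = 1 := fun θ => by
    rw [Complex.mul_conj, Circle.normSq_coe]
    simp
  rcases le_total k j with h | h
  · obtain ⟨d, rfl⟩ := Nat.exists_eq_add_of_le h
    have h2 : ∀ θ, (Circle.exp θ : ℂ) ^ (k + d) * conj (Circle.exp θ : ℂ) ^ k
        = (Circle.exp θ : ℂ) ^ d := fun θ => by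
      rw [pow_add, mul_right_comm, ← mul_pow, h1, one_pow, one_mul]
    simp_rw [h2, integral_angleProb_pow]
    simp
  · obtain ⟨d, rfl⟩ := Nat.exists_eq_add_of_le h
    have h2 : ∀ θ, (Circle.exp θ : ℂ) ^ j * conj (Circle.exp θ : ℂ) ^ (j + d)
        = conj ((Circle.exp θ : ℂ) ^ d) := fun θ => by
      rw [pow_add, ← mul_assoc, ← mul_pow, h1, one_pow, one_mul, map_pow]
    simp_rw [h2, integral_conj, integral_angleProb_pow]
    rcases eq_or_ne d 0 with rfl | hd
    · simp
    · simp [hd]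

/-- Absolute convergence inside the disc allows termwise integration, and orthogonality of the
characters keeps only the `k`-th term. -/
lemma integral_powerSeries_mul_conj_pow {c : ℕ → ℂ} {g : ℂ → ℂ}
    (hg : ∀ x, ‖x‖ < 1 → HasSum (fun j => c j * x ^ j) (g x)) {x : ℂ} (hx : ‖x‖ < 1) (k : ℕ) :
    ∫ θ, g (x * Circle.exp θ) * conj (Circle.exp θ : ℂ) ^ k ∂angleProb = c k * x ^ k := by
  let F : ℕ → ℝ → ℂ := fun j θ =>
    c j * x ^ j * ((Circle.exp θ : ℂ) ^ j * conj (Circle.exp θ : ℂ) ^ k)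
  have hc : ∀ j, Continuous (F j) := fun j => by fun_prop
  have hn : ∀ j θ, ‖F j θ‖ = ‖c j * x ^ j‖ := fun j θ => by simp [F]
  have hint : ∀ j, Integrable (F j) angleProb := fun j =>
    Integrable.of_bound (hc j).aestronglyMeasurable _ (.of_forall fun θ => (hn j θ).le)
  have hs : Summable fun j => ∫ θ, ‖F j θ‖ ∂angleProb := by
    simp_rw [hn]
    simpa using (hg x hx).summable.norm
  have h1 := hasSum_integral_of_summable_integral_norm hint hs
  have h2 : ∀ j, ∫ θ, F j θ ∂angleProb = if j = k then c k * x ^ k else 0 := fun j => by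
    simp only [F]
    rw [integral_const_mul, integral_angleProb_pow_mul_conj_pow]
    split_ifs with h <;> simp [h]
  have h3 : ∀ θ, ∑' j, F j θ = g (x * Circle.exp θ) * conj (Circle.exp θ : ℂ) ^ k := fun θ => by
    refine HasSum.tsum_eq ?_
    convert! (hg (x * Circle.exp θ) (by simpa [Circle.norm_coe] using hx)).mul_right _ using 1
    funext j
    simp only [F]
    ring
  simp_rw [h2, h3] at h1
  exact h1.unique (hasSum_ite_eq k _)

/-- The component along `w` of `z`, plus `ζ` times the orthogonal component. -/
def slice {n : ℕ} (w z : Amb n) (ζ : ℂ) : Amb n :=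
  inner ℂ w z • w + ζ • (z - inner ℂ w z • w)

/-! ### Averaging over the rotations that fix a unit vector -/

section slice

variable {n : ℕ} (w : Sphere n)

lemma inner_self_sphere : inner ℂ (w : Amb n) (w : Amb n) = 1 := by
  rw [inner_self_eq_norm_sq_to_K, norm_eq_of_mem_sphere]
  simp

lemma inner_slice (z : Amb n) (ζ : ℂ) :
    inner ℂ (w : Amb n) (slice (w : Amb n) z ζ) = inner ℂ (w : Amb n) z := by
  simp [slice, inner_self_sphere, -inner_self_eq_norm_sq_to_K]

/-- Pythagoras for the splitting of `z` along `w`. It gives both that `ζ` on the unit circle acts by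
isometries and that `|ζ| ≤ 1` does not increase the norm. -/
lemma norm_slice_sq (z : Amb n) (ζ : ℂ) : ‖slice (w : Amb n) z ζ‖ ^ 2
    = ‖inner ℂ (w : Amb n) z‖ ^ 2 + ‖ζ‖ ^ 2 * ‖z - inner ℂ (w : Amb n) z • (w : Amb n)‖ ^ 2 := by
  have h : inner ℂ (inner ℂ (w : Amb n) z • (w : Amb n))
      (ζ • (z - inner ℂ (w : Amb n) z • (w : Amb n))) = 0 := by
    simp [inner_self_sphere, -inner_self_eq_norm_sq_to_K]
  have h1 := norm_add_sq_eq_norm_sq_add_norm_sq_of_inner_eq_zero _ _ h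
  rw [slice, pow_two, h1, norm_smul, norm_smul, norm_eq_of_mem_sphere]
  ring

lemma slice_one (z : Amb n) : slice (w : Amb n) z 1 = z := by
  simp [slice]

lemma norm_slice_of_norm_eq_one (z : Amb n) {ζ : ℂ} (hζ : ‖ζ‖ = 1) :
    ‖slice (w : Amb n) z ζ‖ = ‖z‖ := by
  have h1 := norm_slice_sq w z ζ
  have h2 := norm_slice_sq w z 1
  rw [slice_one, norm_one] at h2
  rw [hζ, ← h2] at h1
  exact (pow_left_inj₀ (norm_nonneg _) (norm_nonneg _) two_ne_zero).1 h1

lemma norm_slice_le (z : Amb n) {ζ : ℂ} (hζ : ‖ζ‖ ≤ 1) : ‖slice (w : Amb n) z ζ‖ ≤ ‖z‖ := by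
  have h1 := norm_slice_sq w z ζ
  have h2 := norm_slice_sq w z 1
  rw [slice_one, norm_one] at h2
  refine (pow_le_pow_iff_left₀ (norm_nonneg _) (norm_nonneg _) two_ne_zero).1 ?_
  rw [h1, h2]
  gcongr

/-- `z ↦ slice w z ζ` for `|ζ| = 1`, as a unitary map. -/
def sliceIsometry (u : Circle) : Amb n ≃ₗᵢ[ℂ] Amb n :=
  LinearIsometry.toLinearIsometryEquiv
    { toFun := fun z => slice (w : Amb n) z u
      map_add' := fun x y => by
        simp only [slice, inner_add_right, add_smul, smul_sub, smul_add]
        abel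
      map_smul' := fun c x => by
        simp only [slice, inner_smul_right, RingHom.id_apply, mul_smul, smul_sub, smul_add]
        rw [smul_comm (u : ℂ) c x, smul_comm (u : ℂ) c]
      norm_map' := fun z => norm_slice_of_norm_eq_one w z (Circle.norm_coe u) } rfl

lemma coe_sphereMap_sliceIsometry (u : Circle) (z : Sphere n) :
    (sphereMap (sliceIsometry w u) z : Amb n) = slice (w : Amb n) (z : Amb n) u := rfl

/-- Integration over the sphere by averaging over the rotations fixing `w`. -/
lemma integral_sphere_eq_of_average {F G : Sphere n → ℂ} (hF : Continuous F)
    (h : ∀ z : Sphere n, inner ℂ (w : Amb n) (z : Amb n) ≠ 0 →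
      ∫ θ, F (sphereMap (sliceIsometry w (Circle.exp θ)) z) ∂angleProb = G z) :
    ∫ z, F z ∂sphereProb n = ∫ z, G z ∂sphereProb n := by
  have hc : Continuous fun p : ℝ × Sphere n =>
      F (sphereMap (sliceIsometry w (Circle.exp p.1)) p.2) := by
    refine hF.comp (Continuous.subtype_mk ?_ _)
    change Continuous fun p : ℝ × Sphere n => slice (w : Amb n) (p.2 : Amb n) (Circle.exp p.1)
    unfold slice
    fun_prop
  obtain ⟨C, hC⟩ := isCompact_univ.exists_bound_of_continuousOn hF.continuousOn
  calc ∫ z, F z ∂sphereProb n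
      = ∫ _ : ℝ, (∫ z, F z ∂sphereProb n) ∂angleProb := by simp
    -- By rotation invariance the inner integral does not depend on `θ`; Fubini then moves the
    -- average inside.
    _ = ∫ θ, (∫ z, F (sphereMap (sliceIsometry w (Circle.exp θ)) z) ∂sphereProb n) ∂angleProb := by
        congr 1
        funext θ
        have hp := measurePreserving_sphereMap (sliceIsometry w (Circle.exp θ))
        conv_lhs => rw [← hp.map_eq]
        exact integral_map hp.measurable.aemeasurable hF.aestronglyMeasurable
    _ = ∫ z, (∫ θ, F (sphereMap (sliceIsometry w (Circle.exp θ)) z) ∂angleProb) ∂sphereProb n :=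
        integral_integral_swap
          (Integrable.of_bound hc.aestronglyMeasurable C
            (.of_forall fun p => hC _ (Set.mem_univ _)))
    _ = ∫ z, G z ∂sphereProb n :=
        integral_congr_ae ((sphereProb_inner_eq_zero w).mono h)

end slice

namespace TautPow

variable {n μ : ℕ}

/-- The point `(ℂ z, c z^{⊗μ})` for a unit vector `z`. -/
def ofSphere (z : Sphere n) (c : ℂ) : TautPow n μ := ofVec (z : Amb n) z.ne_zero c

lemma norm_vec_ofSphere (z : Sphere n) (c : ℂ) : ‖(ofSphere z c : TautPow n μ).vec‖ = ‖c‖ :=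
  norm_vec_ofVec z c

lemma continuous_ofSphere {α : Type*} [TopologicalSpace α] {f : α → Sphere n} (hf : Continuous f)
    {g : α → ℂ} (hg : Continuous g) : Continuous fun a => (ofSphere (f a) (g a) : TautPow n μ) :=
  continuous_ofVec (continuous_subtype_val.comp hf) _ hg

lemma pairing_ofSphere (z w : Sphere n) (a b : ℂ) :
    pairing (ofSphere z a : TautPow n μ) (ofSphere w b)
      = a * conj b * inner ℂ (w : Amb n) (z : Amb n) ^ μ :=
  pairing_ofVec _ _ _ _ a b

lemma ofVec_smul (v : Amb n) (hv : v ≠ 0) (a : ℂ) (h : a • v ≠ 0) (c : ℂ) :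
    (ofVec (a • v) h c : TautPow n μ) = ofVec v hv (c * a ^ μ) := by
  refine ext ?_ ?_
  · rw [base_ofVec, base_ofVec, Projectivization.mk_eq_mk_iff']
    exact ⟨a, rfl⟩
  · rw [vec_ofVec, vec_ofVec, tpow_smul, smul_smul]

end TautPow

lemma CircleBundle.coe_ofVec_sphere {n μ : ℕ} (z : Sphere n) (u : Circle) :
    (CircleBundle.ofVec (z : Amb n) z.ne_zero u : CircleBundle n μ).1
      = TautPow.ofSphere z (u : ℂ) := by
  simp [CircleBundle.ofVec, TautPow.ofSphere, norm_eq_of_mem_sphere z]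

/-! ### Integrals of disc algebra functions against powers of the pairing -/

section diskAlgebra

open TautPow

variable {n μ : ℕ} {f : TautPow n μ → ℂ} (hf : f ∈ diskAlgebra n μ)

include hf

lemma continuous_comp_of_mem_diskAlgebra {α : Type*} [TopologicalSpace α] {p : α → TautPow n μ}
    (hp : Continuous p) (h : ∀ a, ‖(p a).vec‖ ≤ 1) : Continuous fun a => f (p a) :=
  hf.1.comp_continuous hp h

lemma exists_norm_le_of_mem_diskAlgebra : ∃ C, ∀ ξ : TautPow n μ, ‖ξ.vec‖ ≤ 1 → ‖f ξ‖ ≤ C :=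
  (isCompact_closedDiscBundle n μ).exists_bound_of_continuousOn hf.1

lemma differentiableAt_comp_ofVec {v : ℂ → Amb n} (hv : ∀ x, v x ≠ 0) {c : ℂ → ℂ} {x : ℂ}
    (h1 : Differentiable ℂ v) (h2 : Differentiable ℂ c)
    (hx : ‖(ofVec (v x) (hv x) (c x) : TautPow n μ).vec‖ < 1) :
    DifferentiableAt ℂ (fun x => f (ofVec (v x) (hv x) (c x))) x := by
  rw [← mdifferentiableAt_iff_differentiableAt]
  exact (hf.2.mdifferentiableAt ((isOpen_discBundle n μ).mem_nhds hx)).comp x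
    (mdifferentiableAt_ofVec hv h1 h2)

lemma exists_fibre_powerSeries (w : Sphere n) : ∃ c : ℕ → ℂ, ∀ x : ℂ, ‖x‖ < 1 →
    HasSum (fun j => c j * x ^ j) (f (ofSphere w x)) := by
  have h : DifferentiableOn ℂ (fun x => f (ofSphere w x)) (ball 0 1) := fun x hx =>
    (differentiableAt_comp_ofVec hf (v := fun _ => (w : Amb n)) (fun _ => w.ne_zero) (c := id)
      (differentiable_const _) differentiable_id (by
        simpa [norm_smul, norm_tpow, norm_eq_of_mem_sphere w] using hx)).differentiableWithinAt
  refine ⟨fun j => (j.factorial : ℂ)⁻¹ * iteratedDeriv j (fun x => f (ofSphere w x)) 0,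
    fun x hx => ?_⟩
  convert! Complex.hasSum_taylorSeries_on_ball h (mem_ball_zero_iff.2 hx) using 1
  funext j
  simp only [sub_zero, smul_eq_mul]
  ring

/-- The mean value property on the disc `ζ ↦ slice w z ζ`, whose boundary circle is the rotation
orbit of `z` and whose centre is `⟨w, z⟩ w`, a vector of the line of `w`. The bound on `c` keeps the
whole closed disc inside the open disc bundle. -/
lemma average_ofSphere_slice (w z : Sphere n) (hz : inner ℂ (w : Amb n) (z : Amb n) ≠ 0) {c : ℂ}
    (hc : ‖c‖ < 1) :
    ∫ θ, f (ofSphere (sphereMap (sliceIsometry w (Circle.exp θ)) z) c) ∂angleProb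
      = f (ofSphere w (c * inner ℂ (w : Amb n) (z : Amb n) ^ μ)) := by
  -- The component along `w` is constant on the disc and nonzero, so every point of the disc defines
  -- a line.
  have hv : ∀ x, slice (w : Amb n) (z : Amb n) x ≠ 0 := fun x hx => by
    have := inner_slice w (z : Amb n) x
    rw [hx, inner_zero_right] at this
    exact hz this.symm
  have hd : DifferentiableOn ℂ (fun x => f (ofVec _ (hv x) c)) (closedBall 0 1) := by
    intro x hx
    refine (differentiableAt_comp_ofVec hf hv (c := fun _ => c) ?_ (differentiable_const _)
      ?_).differentiableWithinAt
    · unfold slice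
      fun_prop
    · have h1 := norm_slice_le w (z : Amb n) (mem_closedBall_zero_iff.1 hx)
      rw [norm_eq_of_mem_sphere z] at h1
      rw [vec_ofVec, norm_smul, norm_tpow]
      exact (mul_le_of_le_one_right (norm_nonneg _) (pow_le_one₀ (norm_nonneg _) h1)).trans_lt hc
  have h2 : DiffContOnCl ℂ (fun x => f (ofVec _ (hv x) c)) (ball 0 |1|) := by
    rw [abs_one]
    exact hd.diffContOnCl_ball subset_rfl
  refine (integral_angleProb fun x => f (ofVec _ (hv x) c)).trans (h2.circleAverage.trans ?_)
  have h3 : slice (w : Amb n) (z : Amb n) 0 = inner ℂ (w : Amb n) (z : Amb n) • (w : Amb n) := by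
    simp [slice]
  rw [ofSphere, ← ofVec_smul (w : Amb n) w.ne_zero _ (by simpa [w.ne_zero] using hz)]
  congr 1
  exact ext (by simp only [base_ofVec, h3]) (by simp only [vec_ofVec, h3])

/-- The weight depends on `⟨w, z⟩` alone, which the rotations fixing `w` leave unchanged, so the
average acts on `f` only. -/
lemma integral_sphere_mul_inner (w : Sphere n) {c : ℂ} (hc : ‖c‖ < 1) {W : ℂ → ℂ}
    (hW : Continuous W) :
    ∫ z : Sphere n, f (ofSphere z c) * W (inner ℂ (w : Amb n) (z : Amb n)) ∂sphereProb n
      = ∫ z : Sphere n, f (ofSphere w (c * inner ℂ (w : Amb n) (z : Amb n) ^ μ))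
          * W (inner ℂ (w : Amb n) (z : Amb n)) ∂sphereProb n := by
  refine integral_sphere_eq_of_average w (Continuous.mul ?_ (by fun_prop)) fun z hz => ?_
  · exact continuous_comp_of_mem_diskAlgebra hf (continuous_ofSphere continuous_id continuous_const)
      fun z => (norm_vec_ofSphere z c).trans_le hc.le
  · simp_rw [coe_sphereMap_sliceIsometry, inner_slice]
    rw [integral_mul_const, average_ofSphere_slice hf w z hz hc]

/-- Averaging over rotations replaces `f` by its restriction to the fibre over `w`; the integral
over `θ` extracts the `k`-th Taylor coefficient there; what is left is the moment of order `2kμ` of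
`⟨w, z⟩`, the inverse of `C(kμ + n, n)`. -/
lemma integral_mul_conj_pairing_pow (w : Sphere n) {c : ℕ → ℂ}
    (hg : ∀ x : ℂ, ‖x‖ < 1 → HasSum (fun j => c j * x ^ j) (f (ofSphere w x)))
    {s : ℂ} (hs : ‖s‖ < 1) (k : ℕ) :
    ∫ p : Sphere n × ℝ, f (ofSphere p.1 (s * Circle.exp p.2)) *
        conj ((Circle.exp p.2 : ℂ) * inner ℂ (w : Amb n) (p.1 : Amb n) ^ μ) ^ k
        ∂(sphereProb n).prod angleProb
      = (((k * μ + n).choose n : ℕ) : ℂ)⁻¹ * (c k * s ^ k) := by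
  obtain ⟨C, hC⟩ := exists_norm_le_of_mem_diskAlgebra hf
  have hin : ∀ z : Sphere n, ‖inner ℂ (w : Amb n) (z : Amb n)‖ ≤ 1 := fun z =>
    (norm_inner_le_norm _ _).trans (by simp [norm_eq_of_mem_sphere])
  have hin' : ∀ z : Sphere n, ‖inner ℂ (w : Amb n) (z : Amb n)‖ ^ μ ≤ 1 := fun z =>
    pow_le_one₀ (norm_nonneg _) (hin z)
  have hbound : ∀ (ξ : TautPow n μ) (θ : ℝ) (z : Sphere n), ‖ξ.vec‖ ≤ 1 →
      ‖f ξ * conj ((Circle.exp θ : ℂ) * inner ℂ (w : Amb n) (z : Amb n) ^ μ) ^ k‖ ≤ C := by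
    intro ξ θ z hξ
    rw [norm_mul, norm_pow, RCLike.norm_conj, norm_mul, Circle.norm_coe, one_mul, norm_pow]
    exact (mul_le_of_le_one_right (norm_nonneg _)
      (pow_le_one₀ (by positivity) (hin' z))).trans (hC ξ hξ)
  have hint1 : Integrable (fun p : Sphere n × ℝ => f (ofSphere p.1 (s * Circle.exp p.2)) *
      conj ((Circle.exp p.2 : ℂ) * inner ℂ (w : Amb n) (p.1 : Amb n) ^ μ) ^ k)
      ((sphereProb n).prod angleProb) := by
    have hn : ∀ p : Sphere n × ℝ, ‖(ofSphere p.1 (s * Circle.exp p.2) : TautPow n μ).vec‖ ≤ 1 :=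
      fun p => by simpa [norm_vec_ofSphere, Circle.norm_coe] using hs.le
    refine Integrable.of_bound (Continuous.aestronglyMeasurable (Continuous.mul ?_ (by fun_prop))) C
      (.of_forall fun p => hbound _ _ _ (hn p))
    exact continuous_comp_of_mem_diskAlgebra hf
      (continuous_ofSphere continuous_fst (by fun_prop)) hn
  have hint2 : Integrable (fun p : ℝ × Sphere n =>
      f (ofSphere w (s * Circle.exp p.1 * inner ℂ (w : Amb n) (p.2 : Amb n) ^ μ)) *
      conj ((Circle.exp p.1 : ℂ) * inner ℂ (w : Amb n) (p.2 : Amb n) ^ μ) ^ k)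
      (angleProb.prod (sphereProb n)) := by
    have hn : ∀ p : ℝ × Sphere n, ‖(ofSphere w (s * Circle.exp p.1 *
        inner ℂ (w : Amb n) (p.2 : Amb n) ^ μ) : TautPow n μ).vec‖ ≤ 1 := fun p => by
      rw [norm_vec_ofSphere, norm_mul, norm_mul, Circle.norm_coe, mul_one, norm_pow]
      exact mul_le_one₀ hs.le (by positivity) (hin' p.2)
    refine Integrable.of_bound (Continuous.aestronglyMeasurable (Continuous.mul ?_ (by fun_prop))) C
      (.of_forall fun p => hbound _ _ _ (hn p))
    exact continuous_comp_of_mem_diskAlgebra hf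
      (continuous_ofSphere continuous_const (by fun_prop)) hn
  -- The power `⟨w, z⟩^{kμ}` produced by the Taylor term meets its conjugate from the kernel, whence
  -- the modulus.
  have hfib : ∀ z : Sphere n, ∫ θ,
      f (ofSphere w (s * Circle.exp θ * inner ℂ (w : Amb n) (z : Amb n) ^ μ)) *
        conj ((Circle.exp θ : ℂ) * inner ℂ (w : Amb n) (z : Amb n) ^ μ) ^ k ∂angleProb
      = c k * s ^ k * ((‖inner ℂ (w : Amb n) (z : Amb n)‖ ^ (2 * (k * μ)) : ℝ) : ℂ) := by
    intro z
    have h1 : ‖s * inner ℂ (w : Amb n) (z : Amb n) ^ μ‖ < 1 := by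
      rw [norm_mul, norm_pow]
      exact (mul_le_of_le_one_right (norm_nonneg _) (hin' z)).trans_lt hs
    have h2 := integral_powerSeries_mul_conj_pow hg h1 k
    have h3 : ∀ θ, f (ofSphere w (s * Circle.exp θ * inner ℂ (w : Amb n) (z : Amb n) ^ μ)) *
        conj ((Circle.exp θ : ℂ) * inner ℂ (w : Amb n) (z : Amb n) ^ μ) ^ k
        = f (ofSphere w (s * inner ℂ (w : Amb n) (z : Amb n) ^ μ * Circle.exp θ)) *
          conj (Circle.exp θ : ℂ) ^ k * conj (inner ℂ (w : Amb n) (z : Amb n) ^ μ) ^ k := by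
      intro θ
      rw [mul_right_comm s, map_mul, mul_pow]
      ring
    simp_rw [h3]
    rw [integral_mul_const, h2, Complex.ofReal_pow, pow_mul, ← Complex.mul_conj']
    simp only [mul_pow, map_pow, ← pow_mul]
    rw [mul_comm μ k]
    ring
  calc _ = ∫ θ, ∫ z : Sphere n, f (ofSphere z (s * Circle.exp θ)) *
        conj ((Circle.exp θ : ℂ) * inner ℂ (w : Amb n) (z : Amb n) ^ μ) ^ k
        ∂sphereProb n ∂angleProb := integral_prod_symm _ hint1
    _ = ∫ θ, ∫ z : Sphere n,
        f (ofSphere w (s * Circle.exp θ * inner ℂ (w : Amb n) (z : Amb n) ^ μ)) *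
        conj ((Circle.exp θ : ℂ) * inner ℂ (w : Amb n) (z : Amb n) ^ μ) ^ k
        ∂sphereProb n ∂angleProb := by
      congr 1
      funext θ
      exact integral_sphere_mul_inner hf w (by simpa [Circle.norm_coe] using hs)
        (W := fun a => conj ((Circle.exp θ : ℂ) * a ^ μ) ^ k) (by fun_prop)
    _ = ∫ z : Sphere n, ∫ θ,
        f (ofSphere w (s * Circle.exp θ * inner ℂ (w : Amb n) (z : Amb n) ^ μ)) *
        conj ((Circle.exp θ : ℂ) * inner ℂ (w : Amb n) (z : Amb n) ^ μ) ^ k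
        ∂angleProb ∂sphereProb n := integral_integral_swap hint2
    _ = _ := by
      simp_rw [hfib]
      rw [integral_const_mul, integral_complex_ofReal, integral_inner_pow]
      push_cast
      ring

end diskAlgebra

/-! ### The Szegő kernel -/

section szego

open TautPow

variable {n μ : ℕ}

/-- The function `ξ ↦ P(⟨ξ, η⟩) / (1 - ⟨ξ, η⟩)^{n+1} = ∑ C(kμ + n, n) ⟨ξ, η⟩^k`. -/
def szegoFun (η ξ : TautPow n μ) : ℂ :=
  (szegoPoly n μ).eval (pairing ξ η) / (1 - pairing ξ η) ^ (n + 1)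

lemma norm_pairing_lt_one {ξ η : TautPow n μ} (hη : η ∈ discBundle n μ) (hξ : ‖ξ.vec‖ ≤ 1) :
    ‖pairing ξ η‖ < 1 :=
  ((norm_pairing_le ξ η).trans (mul_le_of_le_one_left (norm_nonneg _) hξ)).trans_lt hη

lemma one_sub_pairing_ne_zero {ξ η : TautPow n μ} (hη : η ∈ discBundle n μ) (hξ : ‖ξ.vec‖ ≤ 1) :
    1 - pairing ξ η ≠ 0 := fun h => by
  have := norm_pairing_lt_one hη hξ
  rw [← sub_eq_zero.1 h, norm_one] at this
  exact lt_irrefl _ this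

/-- For `η` in the open bundle, `|⟨ξ, η⟩| < 1` on the whole closed bundle, so the denominator has no
zero up to the boundary. -/
lemma szegoFun_mem_diskAlgebra {η : TautPow n μ} (hη : η ∈ discBundle n μ) :
    szegoFun η ∈ diskAlgebra n μ := by
  constructor
  · have h : Continuous fun ξ : TautPow n μ => pairing ξ η := continuous_const.inner continuous_vec
    refine ContinuousOn.div ((szegoPoly n μ).continuous.comp h).continuousOn
      (by fun_prop) fun ξ hξ => pow_ne_zero _ (one_sub_pairing_ne_zero hη hξ)
  · intro ξ hξ
    have h1 : DifferentiableAt ℂ (fun t : TensorAmb n μ =>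
        (szegoPoly n μ).eval (inner ℂ η.vec t) / (1 - inner ℂ η.vec t) ^ (n + 1)) ξ.vec := by
      have h2 : DifferentiableAt ℂ (fun t : TensorAmb n μ => inner ℂ η.vec t) ξ.vec :=
        (innerSL ℂ η.vec).differentiableAt
      have h3 : DifferentiableAt ℂ (fun t : TensorAmb n μ =>
          (szegoPoly n μ).eval (inner ℂ η.vec t)) ξ.vec :=
        (szegoPoly n μ).differentiableAt.comp ξ.vec h2
      have h4 : DifferentiableAt ℂ
          (fun t : TensorAmb n μ => (1 - inner ℂ η.vec t) ^ (n + 1)) ξ.vec :=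
        (h2.const_sub 1).fun_pow (n + 1)
      have h5 : (1 - inner ℂ η.vec ξ.vec) ^ (n + 1) ≠ 0 :=
        pow_ne_zero _ (one_sub_pairing_ne_zero hη (le_of_lt hξ))
      simp only [div_eq_mul_inv]
      exact h3.fun_mul (h4.fun_inv h5)
    exact (h1.mdifferentiableAt.comp ξ
      ((contMDiff_vec ξ).mdifferentiableAt (by simp))).mdifferentiableWithinAt

lemma integral_circleMeasure {F : CircleBundle n μ → ℂ} (hF : Continuous F) :
    ∫ ξ, F ξ ∂circleMeasure n μ
      = ∫ p : Sphere n × ℝ, F (CircleBundle.ofVec (p.1 : Amb n) p.1.ne_zero (Circle.exp p.2))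
        ∂(sphereProb n).prod angleProb :=
  integral_map (CircleBundle.continuous_ofVec (continuous_subtype_val.comp continuous_fst) _
    (Circle.exp.continuous.comp continuous_snd)).measurable.aemeasurable hF.aestronglyMeasurable

instance : IsProbabilityMeasure (circleMeasure n μ) :=
  Measure.isProbabilityMeasure_map (μ := (sphereProb n).prod angleProb)
    (CircleBundle.continuous_ofVec (continuous_subtype_val.comp continuous_fst) _
    (Circle.exp.continuous.comp continuous_snd)).measurable.aemeasurable

/-- Summed over `k`, the binomial coefficients of the kernel cancel the moments, leaving the Taylor
series of `f` on the fibre of `w` at `s r`. -/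
lemma integral_dilate_mul_conj_szegoFun {f : TautPow n μ → ℂ} (hf : f ∈ diskAlgebra n μ)
    (w : Sphere n) {r s : ℂ} (hr : ‖r‖ < 1) (hs : ‖s‖ < 1) :
    ∫ p : Sphere n × ℝ, f (ofSphere p.1 (s * Circle.exp p.2)) *
        conj (szegoFun (ofSphere w r : TautPow n μ) (ofSphere p.1 (Circle.exp p.2)))
        ∂(sphereProb n).prod angleProb = f (ofSphere w (s * r)) := by
  obtain ⟨c, hc⟩ := exists_fibre_powerSeries hf w
  obtain ⟨C, hC⟩ := exists_norm_le_of_mem_diskAlgebra hf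
  have hn : ∀ p : Sphere n × ℝ, ‖(ofSphere p.1 (s * Circle.exp p.2) : TautPow n μ).vec‖ ≤ 1 :=
    fun p => by simpa [norm_vec_ofSphere, Circle.norm_coe] using hs.le
  have hin : ∀ z : Sphere n, ‖inner ℂ (w : Amb n) (z : Amb n)‖ ^ μ ≤ 1 := fun z =>
    pow_le_one₀ (norm_nonneg _) ((norm_inner_le_norm _ _).trans (by simp [norm_eq_of_mem_sphere]))
  let d : ℕ → ℂ := fun k => (((k * μ + n).choose n : ℕ) : ℂ) * r ^ k
  have hd : Summable fun k => C * ‖d k‖ := (hasSum_szegoPoly n μ hr).summable.norm.mul_left C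
  let F : ℕ → Sphere n × ℝ → ℂ := fun k p => d k * (f (ofSphere p.1 (s * Circle.exp p.2)) *
    conj ((Circle.exp p.2 : ℂ) * inner ℂ (w : Amb n) (p.1 : Amb n) ^ μ) ^ k)
  have hFc : ∀ k, Continuous (F k) := fun k => by
    refine continuous_const.mul (Continuous.mul ?_ (by fun_prop))
    exact continuous_comp_of_mem_diskAlgebra hf
      (continuous_ofSphere continuous_fst (by fun_prop)) hn
  have hFn : ∀ k p, ‖F k p‖ ≤ C * ‖d k‖ := fun k p => by
    have h1 : ‖conj ((Circle.exp p.2 : ℂ) * inner ℂ (w : Amb n) (p.1 : Amb n) ^ μ) ^ k‖ ≤ 1 := by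
      rw [norm_pow, RCLike.norm_conj, norm_mul, Circle.norm_coe, one_mul, norm_pow]
      exact pow_le_one₀ (by positivity) (hin p.1)
    rw [mul_comm C]
    refine (norm_mul_le _ _).trans (mul_le_mul_of_nonneg_left ?_ (norm_nonneg _))
    refine (norm_mul_le _ _).trans ?_
    exact (mul_le_of_le_one_right (norm_nonneg _) h1).trans (hC _ (hn p))
  have hFi : ∀ k, Integrable (F k) ((sphereProb n).prod angleProb) := fun k =>
    Integrable.of_bound (hFc k).aestronglyMeasurable _ (.of_forall (hFn k))
  have hFs : Summable fun k => ∫ p, ‖F k p‖ ∂(sphereProb n).prod angleProb := by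
    refine Summable.of_nonneg_of_le (fun k => integral_nonneg fun p => norm_nonneg _)
      (fun k => ?_) hd
    simpa using integral_mono (hFi k).norm (integrable_const (C * ‖d k‖)) (hFn k)
  have h1 := hasSum_integral_of_summable_integral_norm hFi hFs
  have h2 : ∀ k, ∫ p, F k p ∂(sphereProb n).prod angleProb = c k * (s * r) ^ k := fun k => by
    have h3 : (((k * μ + n).choose n : ℕ) : ℂ) ≠ 0 := by
      exact_mod_cast (Nat.choose_pos (Nat.le_add_left n _)).ne'
    simp only [F, d]
    rw [integral_const_mul, integral_mul_conj_pairing_pow hf w hc hs k, mul_pow]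
    field_simp
  have h4 : ∀ p : Sphere n × ℝ, ∑' k, F k p = f (ofSphere p.1 (s * Circle.exp p.2)) *
      conj (szegoFun (ofSphere w r : TautPow n μ) (ofSphere p.1 (Circle.exp p.2))) := fun p => by
    refine HasSum.tsum_eq ?_
    have h5 : ‖pairing (ofSphere p.1 (Circle.exp p.2) : TautPow n μ) (ofSphere w r)‖ < 1 :=
      norm_pairing_lt_one (by rwa [discBundle, Set.mem_ofPred_eq, norm_vec_ofSphere])
        (by rw [norm_vec_ofSphere, Circle.norm_coe])
    convert! (Complex.hasSum_conj'.2 (hasSum_szegoPoly n μ h5)).mul_left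
      (f (ofSphere p.1 (s * Circle.exp p.2))) using 1
    funext k
    simp only [F, d, pairing_ofSphere, map_mul, map_pow, Complex.conj_conj, map_natCast, mul_pow]
    ring
  simp_rw [h2, h4] at h1
  refine h1.unique (hc _ ?_)
  rw [norm_mul]
  exact mul_lt_one_of_nonneg_of_lt_one_left (norm_nonneg _) hs hr.le

/-- The reproducing property of the Szegő kernel. -/
lemma eq_integral_mul_conj_szegoFun {f : TautPow n μ → ℂ} (hf : f ∈ diskAlgebra n μ)
    {η : TautPow n μ} (hη : η ∈ discBundle n μ) :
    f η = ∫ ξ : CircleBundle n μ, f ξ.1 * conj (szegoFun η ξ.1) ∂circleMeasure n μ := by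
  have hK := szegoFun_mem_diskAlgebra hη
  have hS : ∀ ξ : CircleBundle n μ, ‖ξ.1.vec‖ ≤ 1 := fun ξ => ξ.2.le
  rw [integral_circleMeasure (F := fun ξ => f ξ.1 * conj (szegoFun η ξ.1))
    ((continuous_comp_of_mem_diskAlgebra hf continuous_subtype_val hS).mul
      (Complex.continuous_conj.comp
        (continuous_comp_of_mem_diskAlgebra hK continuous_subtype_val hS)))]
  simp_rw [CircleBundle.coe_ofVec_sphere]
  obtain ⟨w, r, rfl, hr⟩ := η.exists_eq_ofVec
  have hr1 : ‖r‖ < 1 := hr ▸ hη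
  obtain ⟨C, hC⟩ := exists_norm_le_of_mem_diskAlgebra hf
  obtain ⟨D, hD⟩ := exists_norm_le_of_mem_diskAlgebra hK
  have hn : ∀ (s : ℝ), ‖s‖ ≤ 1 → ∀ p : Sphere n × ℝ,
      ‖(ofSphere p.1 ((s : ℂ) * Circle.exp p.2) : TautPow n μ).vec‖ ≤ 1 :=
    fun s hs p => by simpa [norm_vec_ofSphere, Circle.norm_coe] using hs
  have hn1 : ∀ p : Sphere n × ℝ, ‖(ofSphere p.1 (Circle.exp p.2) : TautPow n μ).vec‖ ≤ 1 :=
    fun p => by simp [norm_vec_ofSphere]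
  -- Only continuity of `f` on the boundary is known, so the identity for dilates is carried to `s =
  -- 1` by dominated convergence from the left.
  have hmem : ∀ᶠ s : ℝ in 𝓝[<] 1, ‖s‖ < 1 := by
    filter_upwards [Ioo_mem_nhdsLT (zero_lt_one (α := ℝ))] with s hs
    rw [Real.norm_of_nonneg hs.1.le]
    exact hs.2
  have hcont : ∀ {c : ℝ → ℂ} {z : Sphere n}, Continuous c → (∀ s : ℝ, ‖s‖ ≤ 1 → ‖c s‖ ≤ 1) →
      Filter.Tendsto (fun s => f (ofSphere z (c s))) (𝓝[<] 1) (𝓝 (f (ofSphere z (c 1)))) := by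
    intro c z hc hc1
    have h1 : ContinuousOn (fun s => f (ofSphere z (c s))) {s : ℝ | ‖s‖ ≤ 1} :=
      hf.1.comp (continuous_ofSphere continuous_const hc).continuousOn fun s hs => by
        rw [closedDiscBundle, Set.mem_ofPred_eq, norm_vec_ofSphere]
        exact hc1 s hs
    refine (h1 1 (by simp)).mono_left (nhdsWithin_le_iff.2 ?_)
    filter_upwards [hmem] with s hs using hs.le
  have hlim1 := hcont (z := w) (c := fun s => (s : ℂ) * r) (by fun_prop) fun s hs => by
    rw [norm_mul, Complex.norm_real]
    exact mul_le_one₀ hs (norm_nonneg _) hr1.le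
  have hlim2 : Filter.Tendsto (fun s : ℝ => ∫ p : Sphere n × ℝ,
      f (ofSphere p.1 ((s : ℂ) * Circle.exp p.2)) *
        conj (szegoFun (ofSphere w r : TautPow n μ) (ofSphere p.1 (Circle.exp p.2)))
        ∂(sphereProb n).prod angleProb) (𝓝[<] 1)
      (𝓝 (∫ p : Sphere n × ℝ, f (ofSphere p.1 (Circle.exp p.2)) *
        conj (szegoFun (ofSphere w r : TautPow n μ) (ofSphere p.1 (Circle.exp p.2)))
        ∂(sphereProb n).prod angleProb)) := by
    have hKc : Continuous fun p : Sphere n × ℝ =>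
        conj (szegoFun (ofSphere w r : TautPow n μ) (ofSphere p.1 (Circle.exp p.2))) :=
      Complex.continuous_conj.comp (continuous_comp_of_mem_diskAlgebra hK
        (continuous_ofSphere continuous_fst (by fun_prop)) hn1)
    refine tendsto_integral_filter_of_dominated_convergence (fun _ => C * D) ?_ ?_
      (integrable_const _) (.of_forall fun p => ?_)
    · filter_upwards [hmem] with s hs
      refine Continuous.aestronglyMeasurable (Continuous.mul ?_ hKc)
      exact continuous_comp_of_mem_diskAlgebra hf
        (continuous_ofSphere continuous_fst (by fun_prop)) (hn s hs.le)
    · filter_upwards [hmem] with s hs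
      refine .of_forall fun p => ?_
      rw [norm_mul, RCLike.norm_conj]
      have h1 := hC _ (hn s hs.le p)
      exact mul_le_mul h1 (hD _ (hn1 p)) (norm_nonneg _) ((norm_nonneg _).trans h1)
    · refine Filter.Tendsto.mul_const _ ?_
      simpa using hcont (z := p.1) (c := fun s => (s : ℂ) * Circle.exp p.2) (by fun_prop)
        fun s hs => by simpa [Circle.norm_coe] using hs
  simp only [Complex.ofReal_one, one_mul] at hlim1
  refine tendsto_nhds_unique hlim1 (hlim2.congr' ?_)
  filter_upwards [hmem] with s hs
  exact integral_dilate_mul_conj_szegoFun hf w hr1 (by simpa using hs)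

/-! ### Representing elements in the Hardy space -/

lemma memLp_of_mem_diskAlgebra {f : TautPow n μ → ℂ} (hf : f ∈ diskAlgebra n μ) :
    MemLp (fun ξ : CircleBundle n μ => f ξ.1) 2 (circleMeasure n μ) := by
  obtain ⟨C, hC⟩ := exists_norm_le_of_mem_diskAlgebra hf
  have hc : Continuous fun ξ : CircleBundle n μ => f ξ.1 :=
    continuous_comp_of_mem_diskAlgebra hf continuous_subtype_val fun ξ => ξ.2.le
  exact MemLp.of_bound hc.aestronglyMeasurable C (.of_forall fun ξ => hC _ ξ.2.le)

lemma toLp_mem_hardySpace {f : TautPow n μ → ℂ} (hf : f ∈ diskAlgebra n μ) :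
    (memLp_of_mem_diskAlgebra hf).toLp _ ∈ hardySpace n μ :=
  Submodule.le_topologicalClosure _ (Submodule.subset_span ⟨f, hf, MemLp.coeFn_toLp _⟩)

lemma representsEval_szegoFun {η : TautPow n μ} (hη : η ∈ discBundle n μ) :
    RepresentsEval n μ η ((memLp_of_mem_diskAlgebra (szegoFun_mem_diskAlgebra hη)).toLp _) := by
  refine ⟨toLp_mem_hardySpace (szegoFun_mem_diskAlgebra hη), fun f hf => ?_⟩
  rw [eq_integral_mul_conj_szegoFun hf hη]
  refine integral_congr_ae ?_
  filter_upwards [MemLp.coeFn_toLp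
    (memLp_of_mem_diskAlgebra (szegoFun_mem_diskAlgebra hη))] with ξ hξ
  rw [hξ]

lemma RepresentsEval.inner_toLp {η : TautPow n μ} {k : Lp ℂ 2 (circleMeasure n μ)}
    (hk : RepresentsEval n μ η k) {f : TautPow n μ → ℂ} (hf : f ∈ diskAlgebra n μ)
    {g : Lp ℂ 2 (circleMeasure n μ)}
    (hg : g =ᵐ[circleMeasure n μ] fun ξ : CircleBundle n μ => f ξ.1) :
    inner ℂ k g = f η := by
  rw [hk.2 f hf, L2.inner_def]
  refine integral_congr_ae ?_
  filter_upwards [hg] with ξ hξ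
  rw [hξ, RCLike.inner_apply]

/-- The reproducing element is unique. -/
lemma RepresentsEval.eq {η : TautPow n μ} {k k' : Lp ℂ 2 (circleMeasure n μ)}
    (hk : RepresentsEval n μ η k) (hk' : RepresentsEval n μ η k') : k = k' := by
  -- The difference is orthogonal to a dense subspace of the Hardy space, yet lies in the Hardy
  -- space.
  have h1 : k - k' ∈ (hardySpace n μ)ᗮ := by
    rw [hardySpace, Submodule.orthogonal_closure, Submodule.mem_orthogonal']
    intro g hg
    induction hg using Submodule.span_induction with
    | mem g hg =>
      obtain ⟨f, hf, hg⟩ := hg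
      rw [inner_sub_left, hk.inner_toLp hf hg, hk'.inner_toLp hf hg, sub_self]
    | zero => simp
    | add x y _ _ hx hy => rw [inner_add_right, hx, hy, add_zero]
    | smul a x _ hx => rw [inner_smul_right, hx, mul_zero]
  have h2 : k - k' ∈ hardySpace n μ := sub_mem hk.1 hk'.1
  have h3 := (Submodule.mem_orthogonal _ _).1 h1 _ h2
  exact sub_eq_zero.1 (inner_self_eq_zero.1 h3)

/-- By uniqueness `k η` is the class of `szegoFun η`, and its inner product with `k ξ` is evaluation
at `ξ`. -/
lemma IsSzegoKernel.eq_szegoFun {K : TautPow n μ → TautPow n μ → ℂ} (hK : IsSzegoKernel n μ K)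
    {ξ η : TautPow n μ} (hξ : ξ ∈ discBundle n μ) (hη : η ∈ discBundle n μ) :
    K ξ η = szegoFun η ξ := by
  obtain ⟨k, hk, hK⟩ := hK
  rw [hK ξ hξ η hη, (hk η hη).eq (representsEval_szegoFun hη)]
  exact (hk ξ hξ).inner_toLp (szegoFun_mem_diskAlgebra hη) (MemLp.coeFn_toLp _)

lemma exists_isSzegoKernel (n μ : ℕ) : ∃ K, IsSzegoKernel n μ K := by
  classical
  let k : TautPow n μ → Lp ℂ 2 (circleMeasure n μ) := fun η =>
    if hη : η ∈ discBundle n μ then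
      (memLp_of_mem_diskAlgebra (szegoFun_mem_diskAlgebra hη)).toLp _ else 0
  refine ⟨fun ξ η => inner ℂ (k ξ) (k η), k, fun η hη => ?_, fun _ _ _ _ => rfl⟩
  simp only [k, dif_pos hη]
  exact representsEval_szegoFun hη

lemma contMDiff_pairing : ContMDiff (𝓘(ℝ, (Fin n → ℂ) × ℂ).prod 𝓘(ℝ, (Fin n → ℂ) × ℂ)) 𝓘(ℝ, ℂ) ∞
    fun p : TautPow n μ × TautPow n μ => pairing p.1 p.2 := by
  have h1 : ContDiff ℝ ∞ fun p : TensorAmb n μ × TensorAmb n μ => inner ℂ p.2 p.1 :=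
    contDiff_snd.inner ℂ contDiff_fst
  exact h1.contMDiff.comp ((contMDiff_real_vec.comp contMDiff_fst).prodMk_space
    (contMDiff_real_vec.comp contMDiff_snd))

lemma IsSzegoKernel.hasNoLogTerm {K : TautPow n μ → TautPow n μ → ℂ} (hK : IsSzegoKernel n μ K) :
    HasNoLogTerm n μ K := by
  -- The coefficient `φ = P(⟨ξ, η⟩)` is smooth on the whole product, so the neighbourhood need not
  -- be shrunk.
  refine ⟨fun p => (szegoPoly n μ).eval (pairing p.1 p.2), Set.univ, isOpen_univ,
    fun _ => Set.mem_univ _, ?_, contMDiff_const.contMDiffOn, fun ξ hξ η hη _ => ?_⟩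
  · have h1 : ContDiff ℝ ∞ fun t : ℂ => (szegoPoly n μ).eval t :=
      ContDiff.restrict_scalars ℝ (by simpa using (szegoPoly n μ).contDiff_aeval (𝕜 := ℂ) ∞)
    exact (h1.contMDiff.comp contMDiff_pairing).contMDiffOn
  · rw [hK.eq_szegoFun hξ hη, szegoFun, rho]
    simp

end szego

/-! ### The circle bundles as lens spaces -/

section lens

variable {n μ : ℕ}

/-- The map `z ↦ (ℂ z, z^{⊗μ})` from the sphere to the circle bundle. -/
def sphereProj (μ : ℕ) (z : Sphere n) : CircleBundle n μ :=
  CircleBundle.ofVec (z : Amb n) z.ne_zero 1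

lemma continuous_sphereProj : Continuous (sphereProj μ : Sphere n → _) :=
  CircleBundle.continuous_ofVec continuous_subtype_val _ continuous_const

/-- Multiplication of a point of the sphere by a unit complex number. -/
def circleSMul (u : Circle) (z : Sphere n) : Sphere n :=
  ⟨(u : ℂ) • (z : Amb n), by simp [norm_smul, norm_eq_of_mem_sphere z, Circle.norm_coe]⟩

lemma coe_circleSMul (u : Circle) (z : Sphere n) :
    (circleSMul u z : Amb n) = (u : ℂ) • (z : Amb n) := rfl

lemma ofVec_circleSMul (u : Circle) (z : Sphere n) (c : Circle) :
    (CircleBundle.ofVec (circleSMul u z : Amb n) (circleSMul u z).ne_zero c : CircleBundle n μ)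
      = CircleBundle.ofVec (z : Amb n) z.ne_zero (c * u ^ μ) := by
  apply Subtype.ext
  rw [CircleBundle.coe_ofVec_sphere, CircleBundle.coe_ofVec_sphere, Circle.coe_mul, Circle.coe_pow]
  exact TautPow.ofVec_smul _ _ _ _ _

/-- Equal base points give `z = u z'` with `|u| = 1`; comparing `u^μ z'^{⊗μ}` with `z'^{⊗μ}` then
forces `u^μ = 1`. -/
lemma sphereProj_eq_iff {z z' : Sphere n} :
    sphereProj μ z = sphereProj μ z' ↔ ∃ u : Circle, u ^ μ = 1 ∧ z = circleSMul u z' := by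
  constructor
  · intro h
    have hb : Projectivization.mk ℂ (z : Amb n) z.ne_zero
        = Projectivization.mk ℂ (z' : Amb n) z'.ne_zero := congrArg CircleBundle.base h
    obtain ⟨a, ha⟩ := (Projectivization.mk_eq_mk_iff' _ _ _ _ _).1 hb
    have hn : ‖a‖ = 1 := by
      have := congrArg norm ha
      rwa [norm_smul, norm_eq_of_mem_sphere, norm_eq_of_mem_sphere, mul_one] at this
    let u : Circle := ⟨a, mem_sphere_zero_iff_norm.2 hn⟩
    have hz : z = circleSMul u z' := Subtype.ext ha.symm
    refine ⟨u, Circle.ext ?_, hz⟩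
    rw [hz, sphereProj, ofVec_circleSMul, one_mul] at h
    have hv := congrArg CircleBundle.vec h
    simp only [sphereProj, CircleBundle.vec_ofVec, norm_eq_of_mem_sphere] at hv
    have ht : tpow μ (z' : Amb n) ≠ 0 := by
      rw [← norm_ne_zero_iff, norm_tpow, norm_eq_of_mem_sphere]
      simp
    simpa using smul_left_injective ℂ ht hv
  · rintro ⟨u, hu, rfl⟩
    rw [sphereProj, ofVec_circleSMul, hu, mul_one]
    rfl

lemma exists_circle_pow_eq [NeZero μ] (u : Circle) : ∃ v : Circle, v ^ μ = u := by
  obtain ⟨t, rfl⟩ := Circle.exp_surjective u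
  refine ⟨Circle.exp (t / μ), ?_⟩
  rw [← Circle.exp_nsmul, nsmul_eq_mul, mul_div_cancel₀ _ (NeZero.ne _)]

lemma surjective_sphereProj [NeZero μ] : Function.Surjective (sphereProj μ : Sphere n → _) := by
  intro ξ
  obtain ⟨w, r, h, hr⟩ := ξ.1.exists_eq_ofVec
  obtain ⟨c, rfl⟩ : ∃ c : Circle, (c : ℂ) = r :=
    ⟨⟨r, mem_sphere_zero_iff_norm.2 (hr.symm.trans ξ.2)⟩, rfl⟩
  obtain ⟨v, hv⟩ := exists_circle_pow_eq (μ := μ) c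
  refine ⟨circleSMul v w, Subtype.ext ?_⟩
  rw [sphereProj, ofVec_circleSMul, CircleBundle.coe_ofVec_sphere, hv, one_mul]
  exact h.symm

/-! ### Smoothness in trivializations and local sections of the projection -/

variable {E H M : Type*} [NormedAddCommGroup E] [NormedSpace ℝ E] [TopologicalSpace H]
  {I : ModelWithCorners ℝ E H} [TopologicalSpace M] [ChartedSpace H M]

/-- Smoothness can be tested in a trivialization with values in `ℂ^n × Circle`, treating the circle
as a manifold and never unfolding its charts. -/
lemma contMDiffAt_circleBundle_of_chart {f : M → CircleBundle n μ} {x : M} (hf : ContinuousAt f x)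
    (h : ∀ i, (f x).base ∈ affineSet i →
      ContMDiffAt I (circleModel n) ∞ (fun y => CircleBundle.chart i (f y)) x) :
    ContMDiffAt I (circleModel n) ∞ f x :=
  contMDiffAt_iff.2 ⟨hf, (contMDiffAt_iff.1
    (h _ (TautPow.exists_mem_affineSet (f x).base).choose_spec)).2⟩

lemma contMDiffAt_circleBundle_of_chart_symm {g : CircleBundle n μ → M} {ξ : CircleBundle n μ}
    (hg : ContinuousAt g ξ) (h : ∀ i, ξ.base ∈ affineSet i →
      ContMDiffAt (circleModel n) I ∞ (fun p => g ((CircleBundle.chart i).symm p))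
        (CircleBundle.chart i ξ)) :
    ContMDiffAt (circleModel n) I ∞ g ξ := by
  have h1 := h _ (TautPow.exists_mem_affineSet ξ.base).choose_spec
  refine contMDiffAt_iff.2 ⟨hg, ?_⟩
  have h2 := (contMDiffAt_iff.1 h1).2
  rw [(CircleBundle.chart _).left_inv (TautPow.exists_mem_affineSet ξ.base).choose_spec] at h2
  exact h2

lemma contMDiff_sphereProj :
    ContMDiff (𝓡 (2 * n + 1)) (circleModel n) ∞ (sphereProj μ : Sphere n → _) := by
  intro z
  refine contMDiffAt_circleBundle_of_chart continuous_sphereProj.continuousAt fun i hi => ?_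
  have hzi : (z : Amb n) i ≠ 0 := (mk_mem_affineSet z.ne_zero).1 hi
  have hc : ContMDiff (𝓡 (2 * n + 1)) 𝓘(ℝ, Amb n) ∞ (fun z : Sphere n => (z : Amb n)) :=
    contMDiff_coe_sphere
  have hk : ∀ k, ContDiff ℝ ∞ fun x : Amb n => x k := fun k => contDiff_piLp_apply 2
  have h1 : ContDiffAt ℝ ∞ (fun x : Amb n => (fun j => x (i.succAbove j) / x i : Fin n → ℂ)) z :=
    contDiffAt_pi.2 fun j => by
      simp only [div_eq_mul_inv]
      exact (hk _).contDiffAt.mul ((hk i).contDiffAt.inv hzi)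
  have h2 : ContMDiffAt 𝓘(ℝ, Amb n) (𝓡 1) ∞ (fun x : Amb n => phase (x i ^ μ)) z :=
    (CircleBundle.contMDiffAt_phase (pow_ne_zero μ hzi)).comp (z : Amb n)
      (((hk i).pow μ).contDiffAt.contMDiffAt)
  refine ((h1.contMDiffAt.comp z hc.contMDiffAt).prodMk
    (h2.comp z hc.contMDiffAt)).congr_of_eventuallyEq (.of_forall fun y => ?_)
  simp [CircleBundle.chart_apply, sphereProj, affineCoord_mk, norm_eq_of_mem_sphere y]

/-- A local branch of the `μ`-th root on the circle near `v ^ μ`. -/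
def rootBranch (μ : ℕ) (v u : Circle) : Circle :=
  v * Circle.exp ((Complex.log ((u : ℂ) / (v : ℂ) ^ μ)).im / μ)

/-- Valid for every `u`, also across the cut of the logarithm, because `exp (i arg)` recovers a unit
number. Only smoothness is local. -/
lemma rootBranch_pow [NeZero μ] (v u : Circle) : rootBranch μ v u ^ μ = u := by
  have h : Circle.exp ((Complex.log ((u : ℂ) / (v : ℂ) ^ μ)).im) = u / v ^ μ := by
    rw [Complex.log_im, ← Circle.coe_pow, ← Circle.coe_div, Circle.exp_arg]
  rw [rootBranch, mul_pow, ← Circle.exp_nsmul, nsmul_eq_mul, mul_div_cancel₀ _ (NeZero.ne _), h]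
  simp

lemma rootBranch_self (v : Circle) : rootBranch μ v (v ^ μ) = v := by
  simp [rootBranch]

lemma contMDiffAt_rootBranch (v : Circle) :
    ContMDiffAt (𝓡 1) (𝓡 1) ∞ (rootBranch μ v) (v ^ μ) := by
  have : Fact (Module.finrank ℝ ℂ = 1 + 1) := ⟨Complex.finrank_real_complex⟩
  have hc : ContMDiff (𝓡 1) 𝓘(ℝ, ℂ) ∞ (fun u : Circle => (u : ℂ)) :=
    contMDiff_coe_sphere (E := ℂ)
  have h1 : ContDiffAt ℝ ∞ (fun x : ℂ => (Complex.log (x / (v : ℂ) ^ μ)).im / μ)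
      ((v ^ μ : Circle) : ℂ) := by
    have h2 : ContDiffAt ℂ ∞ (fun x : ℂ => Complex.log (x / (v : ℂ) ^ μ)) ((v ^ μ : Circle) : ℂ) :=
      (Complex.contDiffAt_log (by simp)).comp _ (contDiffAt_id.div_const _)
    exact (Complex.imCLM.contDiff.contDiffAt.comp _ (h2.restrict_scalars ℝ)).div_const _
  exact contMDiffAt_const.mul
    (contMDiff_circleExp.contMDiffAt.comp _ (h1.contMDiffAt.comp _ hc.contMDiffAt))

/-- The normalization of `affineVec`. -/
def unitAffineVec (i : Fin (n + 1)) (w : Fin n → ℂ) : Sphere n :=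
  ⟨(‖affineVec i w‖⁻¹ : ℝ) • affineVec i w, by
    simp [norm_smul, affineVec_ne_zero]⟩

lemma contMDiff_unitAffineVec (i : Fin (n + 1)) :
    ContMDiff 𝓘(ℝ, Fin n → ℂ) (𝓡 (2 * n + 1)) ∞ (unitAffineVec i) := by
  have h1 : ContDiff ℝ ∞ (affineVec i : (Fin n → ℂ) → Amb n) :=
    ((contDiff_affineVec i).restrict_scalars ℝ).of_le (by simp)
  have h2 : ContDiff ℝ ∞ fun w : Fin n → ℂ => (‖affineVec i w‖⁻¹ : ℝ) • affineVec i w :=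
    ((h1.norm ℂ fun w => affineVec_ne_zero i w).inv
      fun w => norm_ne_zero_iff.2 (affineVec_ne_zero i w)).smul h1
  exact h2.contMDiff.codRestrict_sphere fun w => (unitAffineVec i w).2

lemma contMDiff_circleSMul : ContMDiff ((𝓡 1).prod (𝓡 (2 * n + 1))) (𝓡 (2 * n + 1)) ∞
    fun p : Circle × Sphere n => circleSMul p.1 p.2 := by
  have : Fact (Module.finrank ℝ ℂ = 1 + 1) := ⟨Complex.finrank_real_complex⟩
  have hc : ContMDiff (𝓡 1) 𝓘(ℝ, ℂ) ∞ (fun u : Circle => (u : ℂ)) :=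
    contMDiff_coe_sphere (E := ℂ)
  have hs : ContMDiff (𝓡 (2 * n + 1)) 𝓘(ℝ, Amb n) ∞ (fun z : Sphere n => (z : Amb n)) :=
    contMDiff_coe_sphere
  have h1 : ContDiff ℝ ∞ fun p : ℂ × Amb n => p.1 • p.2 := contDiff_fst.smul contDiff_snd
  exact (h1.contMDiff.comp ((hc.comp contMDiff_fst).prodMk_space
    (hs.comp contMDiff_snd))).codRestrict_sphere fun p => (circleSMul p.1 p.2).2

/-- With `z = z_i v` and `|z| = 1` one has `|z_i| |v| = 1`, so `z` is the phase of `z_i` times `v /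
|v|`. This makes the local section pass through the prescribed point. -/
lemma circleSMul_phase_unitAffineVec {z : Sphere n} {i : Fin (n + 1)} (hi : (z : Amb n) i ≠ 0) :
    circleSMul (phase ((z : Amb n) i))
      (unitAffineVec i (affineCoord i (Projectivization.mk ℂ (z : Amb n) z.ne_zero))) = z := by
  have hv : (z : Amb n) = (z : Amb n) i • affineVec i
      (affineCoord i (Projectivization.mk ℂ (z : Amb n) z.ne_zero)) := by
    rw [affineCoord_mk]
    ext k
    rcases Fin.eq_self_or_eq_succAbove i k with rfl | ⟨j, rfl⟩
    · simp
    · simp [mul_div_cancel₀ _ hi]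
  apply Subtype.ext
  rw [coe_circleSMul]
  generalize affineCoord i (Projectivization.mk ℂ (z : Amb n) z.ne_zero) = w at hv
  have hn : ‖(z : Amb n) i‖ * ‖affineVec i w‖ = 1 := by
    rw [← norm_smul, ← hv, norm_eq_of_mem_sphere]
  have hn' : ‖affineVec i w‖⁻¹ = ‖(z : Amb n) i‖ := (eq_inv_of_mul_eq_one_left hn).symm
  have hz : ‖(z : Amb n) i‖ ≠ 0 := norm_ne_zero_iff.2 hi
  conv_rhs => rw [hv]
  simp only [unitAffineVec, hn', coe_phase hi]
  rw [← Complex.coe_smul, smul_smul, div_mul_cancel₀]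
  exact_mod_cast hz

/-- The projection `z ↦ (ℂ z, z^{⊗μ})` has smooth local sections. -/
lemma exists_local_section [NeZero μ] (z : Sphere n) : ∃ s : CircleBundle n μ → Sphere n,
    s (sphereProj μ z) = z ∧ (∀ᶠ ξ in 𝓝 (sphereProj μ z), sphereProj μ (s ξ) = ξ) ∧
    ContMDiffAt (circleModel n) (𝓡 (2 * n + 1)) ∞ s (sphereProj μ z) := by
  obtain ⟨i, hi⟩ := TautPow.exists_mem_affineSet (sphereProj μ z).base
  have hi' : (z : Amb n) i ≠ 0 := (mk_mem_affineSet z.ne_zero).1 hi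
  let v : Circle := phase ((z : Amb n) i)
  -- Over the point with coordinates `(w, u)`, rotate the normalized vector of the line by a `μ`-th
  -- root of `u`, on the branch through the phase of `z_i`.
  let σ : (Fin n → ℂ) × Circle → Sphere n := fun p =>
    circleSMul (rootBranch μ v p.2) (unitAffineVec i p.1)
  have hchart : CircleBundle.chart i (sphereProj μ z)
      = (affineCoord i (Projectivization.mk ℂ (z : Amb n) z.ne_zero), v ^ μ) := by
    rw [CircleBundle.chart_apply]
    refine Prod.ext rfl ?_
    have := CircleBundle.phase_mul_pow 1 hi' one_pos μ
    simpa [sphereProj, norm_eq_of_mem_sphere z] using this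
  have hσ : ContMDiffAt (circleModel n) (𝓡 (2 * n + 1)) ∞ σ
      (CircleBundle.chart i (sphereProj μ z)) := by
    rw [hchart]
    have h1 : ContMDiffAt (circleModel n) (𝓡 1) ∞
        (fun p : (Fin n → ℂ) × Circle => rootBranch μ v p.2)
        (affineCoord i (Projectivization.mk ℂ (z : Amb n) z.ne_zero), v ^ μ) :=
      ContMDiffAt.comp (g := rootBranch μ v) (f := Prod.snd) _ (contMDiffAt_rootBranch v)
        contMDiffAt_snd
    exact contMDiff_circleSMul.contMDiffAt.comp _
      (h1.prodMk ((contMDiff_unitAffineVec i).contMDiffAt.comp _ contMDiffAt_fst))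
  have hsec : ∀ p, sphereProj μ (σ p) = (CircleBundle.chart i).symm p := fun p => by
    rw [sphereProj, ofVec_circleSMul, one_mul, rootBranch_pow, CircleBundle.chart_symm_apply]
    apply Subtype.ext
    rw [CircleBundle.coe_ofVec_sphere]
    have h0 : (((‖affineVec i p.1‖⁻¹ : ℝ) : ℂ)) • affineVec i p.1 ≠ 0 := by
      simp [affineVec_ne_zero]
    refine (TautPow.ofVec_smul (affineVec i p.1) (affineVec_ne_zero i p.1) _ h0 _).trans ?_
    simp [CircleBundle.ofVec, div_eq_mul_inv]
  have hmem : (CircleBundle.chart i : OpenPartialHomeomorph (CircleBundle n μ) _).source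
      ∈ 𝓝 (sphereProj μ z) := (CircleBundle.chart i).open_source.mem_nhds hi
  have hs : ContMDiffAt (circleModel n) (𝓡 (2 * n + 1)) ∞ (fun ξ => σ (CircleBundle.chart i ξ))
      (sphereProj μ z) := by
    refine contMDiffAt_circleBundle_of_chart_symm
      (hσ.continuousAt.comp ((CircleBundle.chart i).continuousAt hi)) fun j hj => ?_
    -- The preferred chart at the point may have an index `j` different from `i`, so the section is
    -- read through the transition map.
    have h1 := (CircleBundle.contMDiffOn_transition (μ := μ) j i).contMDiffAt
      (x := CircleBundle.chart j (sphereProj μ z))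
      ((OpenPartialHomeomorph.open_source _).mem_nhds ⟨Set.mem_univ _, by
        change (CircleBundle.chart j).symm (CircleBundle.chart j (sphereProj μ z)) ∈
          (CircleBundle.chart i).source
        rwa [OpenPartialHomeomorph.left_inv _ hj]⟩)
    have h2 := congrArg (CircleBundle.chart (μ := μ) i) ((CircleBundle.chart j).left_inv hj)
    rw [← h2] at hσ
    exact ContMDiffAt.comp (g := σ) (CircleBundle.chart j (sphereProj μ z)) hσ h1
  refine ⟨fun ξ => σ (CircleBundle.chart i ξ), ?_, ?_, hs⟩
  · simp only [hchart, σ, rootBranch_self, v]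
    exact circleSMul_phase_unitAffineVec hi'
  · filter_upwards [hmem] with ξ hξ
    rw [hsec, (CircleBundle.chart i).left_inv hξ]

end lens

/-! ### The smooth structure of the lens space and the diffeomorphism -/

section lensDiffeomorph

variable {n μ : ℕ} [NeZero μ]

/-- The roots of unity form a finite group acting freely. -/
lemma isCoveringMap_lensMk :
    IsCoveringMap (Quotient.mk'' : Sphere n → LensSpace n μ) :=
  isQuotientCoveringMap_quotientMk_of_properlyDiscontinuousSMul.isCoveringMap

lemma exists_chartAt_lensSpace (x : LensSpace n μ) : ∃ e : Sphere n, Quotient.mk'' e = x ∧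
    chartAt (EuclideanSpace ℝ (Fin (2 * n + 1))) x
      = ((isCoveringMap_lensMk (n := n) (μ := μ)).isLocalHomeomorph.localInverseAt e).trans
        (chartAt (EuclideanSpace ℝ (Fin (2 * n + 1))) e) :=
  ⟨_, (Quotient.mk_surjective (s := MulAction.orbitRel (rootsOfUnity μ ℂ)
    (Sphere n))).hasRightInverse.choose_spec x, rfl⟩

variable {E H M : Type*} [NormedAddCommGroup E] [NormedSpace ℝ E] [TopologicalSpace H]
  {I : ModelWithCorners ℝ E H} [TopologicalSpace M] [ChartedSpace H M]

/-- The charts of the quotient are local inverses of the projection followed by charts of the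
sphere, so `F` and its lift have the same coordinate expression. -/
lemma contMDiff_lensSpace_of_comp_mk {F : LensSpace n μ → M}
    (h : ContMDiff (𝓡 (2 * n + 1)) I ∞ fun z : Sphere n => F (Quotient.mk'' z)) :
    ContMDiff (𝓡 (2 * n + 1)) I ∞ F := by
  intro x
  obtain ⟨e, rfl, hx⟩ := exists_chartAt_lensSpace x
  have hF : Continuous F := isQuotientMap_quotient_mk'.continuous_iff.2 h.continuous
  refine contMDiffAt_iff.2 ⟨hF.continuousAt, ?_⟩
  have h1 := (contMDiffAt_iff.1 (h e)).2
  convert! h1 using 1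
  · funext y
    simp [extChartAt, hx]
  · simp only [extChartAt, hx, mfld_simps]
    rw [IsLocalHomeomorph.localInverseAt_apply_self]

/-- A smooth lift is required through every preimage `e`, because the chart at `G x` is built on an
unspecified one. -/
lemma contMDiffAt_lensSpace_of_lift {G : M → LensSpace n μ} {x : M}
    (h : ∀ e : Sphere n, Quotient.mk'' e = G x → ∃ s : M → Sphere n, s x = e ∧
      (∀ᶠ y in 𝓝 x, Quotient.mk'' (s y) = G y) ∧ ContMDiffAt I (𝓡 (2 * n + 1)) ∞ s x) :
    ContMDiffAt I (𝓡 (2 * n + 1)) ∞ G x := by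
  obtain ⟨e, he, hx⟩ := exists_chartAt_lensSpace (G x)
  obtain ⟨s, rfl, hs, hc⟩ := h e he
  have hq := (isCoveringMap_lensMk (n := n) (μ := μ)).isLocalHomeomorph
  have hG : ContinuousAt G x :=
    (hq.continuous.continuousAt.comp hc.continuousAt).congr hs
  refine contMDiffAt_iff.2 ⟨hG, ?_⟩
  have key : ∀ᶠ y in 𝓝 x, extChartAt (𝓡 (2 * n + 1)) (G x) (G y)
      = extChartAt (𝓡 (2 * n + 1)) (s x) (s y) := by
    have h2 : (hq.localInverseAt (s x)).target ∈ 𝓝 (s x) :=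
      (hq.localInverseAt (s x)).open_target.mem_nhds hq.self_mem_localInverseAt_target
    filter_upwards [hs, hc.continuousAt h2] with y hy hy2
    have h3 : hq.localInverseAt (s x) (G y) = s y := by
      rw [← hy, ← congrFun (hq.localInverseAt_symm (s x)) (s y)]
      exact (hq.localInverseAt (s x)).right_inv hy2
    simp only [extChartAt, hx, mfld_simps]
    rw [h3]
  have h4 : Filter.Tendsto (extChartAt I x).symm (𝓝[Set.range I] (extChartAt I x x)) (𝓝 x) := by
    have h5 := (continuousAt_extChartAt_symm (I := I) x).tendsto
    rw [extChartAt_to_inv] at h5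
    exact h5.mono_left nhdsWithin_le_nhds
  refine (contMDiffAt_iff.1 hc).2.congr_of_eventuallyEq (h4.eventually key) ?_
  simpa using key.self_of_nhds

lemma sphereProj_eq_iff_orbit {z z' : Sphere n} :
    sphereProj μ z = sphereProj μ z' ↔
      (MulAction.orbitRel (rootsOfUnity μ ℂ) (Sphere n)).r z z' := by
  rw [sphereProj_eq_iff]
  constructor
  · rintro ⟨u, hu, rfl⟩
    have hu' : (u : ℂ) ^ μ = 1 := by rw [← Circle.coe_pow, hu, Circle.coe_one]
    exact ⟨rootsOfUnity.mkOfPowEq (u : ℂ) hu', Subtype.ext rfl⟩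
  · rintro ⟨ζ, rfl⟩
    obtain ⟨u, hu⟩ : ∃ u : Circle, (u : ℂ) = ((ζ : ℂˣ) : ℂ) :=
      ⟨⟨((ζ : ℂˣ) : ℂ), mem_sphere_zero_iff_norm.2
        (Complex.norm_eq_one_of_mem_rootsOfUnity ζ.2)⟩, rfl⟩
    refine ⟨u, Circle.ext ?_, Subtype.ext ?_⟩
    · rw [Circle.coe_pow, hu, Circle.coe_one]
      exact (mem_rootsOfUnity' μ _).1 ζ.2
    · rw [coe_circleSMul, hu]
      rfl

/-- The bijection of the lens space onto the circle bundle induced by `z ↦ (ℂ z, z^{⊗μ})`. -/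
def lensEquiv (n μ : ℕ) [NeZero μ] : LensSpace n μ ≃ CircleBundle n μ :=
  Equiv.ofBijective (Quotient.lift (sphereProj μ) fun _ _ h => sphereProj_eq_iff_orbit.2 h) (by
    constructor
    · intro x y
      induction x using Quotient.inductionOn with | h z => ?_
      induction y using Quotient.inductionOn with | h z' => ?_
      exact fun h => Quotient.sound (sphereProj_eq_iff_orbit.1 h)
    · intro ξ
      obtain ⟨z, rfl⟩ := surjective_sphereProj ξ
      exact ⟨Quotient.mk'' z, rfl⟩)

lemma lensEquiv_mk (z : Sphere n) : lensEquiv n μ (Quotient.mk'' z) = sphereProj μ z := rfl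

/-- The diffeomorphism of the lens space onto the circle bundle induced by `z ↦ (ℂ z, z^{⊗μ})`. -/
def lensDiffeomorph (n μ : ℕ) [NeZero μ] :
    LensSpace n μ ≃ₘ^∞⟮𝓡 (2 * n + 1), circleModel n⟯ CircleBundle n μ where
  toEquiv := lensEquiv n μ
  contMDiff_toFun := contMDiff_lensSpace_of_comp_mk contMDiff_sphereProj
  contMDiff_invFun ξ := by
    refine contMDiffAt_lensSpace_of_lift fun e he => ?_
    have h1 : sphereProj μ e = ξ := by
      rw [← lensEquiv_mk, he, Equiv.apply_symm_apply]
    obtain ⟨s, hs, hs', hc⟩ := exists_local_section (μ := μ) e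
    rw [h1] at hs hs' hc
    refine ⟨s, hs, hs'.mono fun y hy => ?_, hc⟩
    rw [Equiv.eq_symm_apply, lensEquiv_mk, hy]

lemma lensDiffeomorph_mk (z : Sphere n) :
    lensDiffeomorph n μ (Quotient.mk'' z) = CircleBundle.ofVec (z : Amb n) z.ne_zero 1 := rfl

end lensDiffeomorph

/-! ### Coverings of spheres -/

section sphereCovering

open Module

variable {E X : Type*} [NormedAddCommGroup E] [InnerProductSpace ℝ E] [TopologicalSpace X]
  {p : X → sphere (0 : E) 1}

/-- Stereographic projection identifies the punctured sphere with a vector space, and its inverse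
lifts through any covering. -/
lemma exists_section_compl_singleton_of_isCoveringMap (hp : IsCoveringMap p)
    {N b : sphere (0 : E) 1} (hb : b ≠ N)
    {x : X} (hx : p x = b) :
    ∃ s : sphere (0 : E) 1 → X, ContinuousOn s {N}ᶜ ∧ s b = x ∧ ∀ z ≠ N, p (s z) = z := by
  let σ := stereographic (norm_eq_of_mem_sphere N)
  have hsrc : σ.source = {N}ᶜ := stereographic_source _
  have hσ : Continuous σ.symm := by
    rw [← continuousOn_univ]
    exact σ.continuousOn_invFun
  have hb' : σ.symm (σ b) = b := σ.left_inv (hsrc ▸ hb)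
  obtain ⟨F, ⟨hF, hF'⟩, -⟩ := hp.existsUnique_continuousMap_lifts ⟨σ.symm, hσ⟩ (σ b) x
    (hx.trans hb'.symm)
  refine ⟨F ∘ σ, F.continuous.comp_continuousOn (hsrc ▸ σ.continuousOn), hF, fun z hz => ?_⟩
  exact (congrFun hF' (σ z)).trans (σ.left_inv (hsrc ▸ hz))

lemma sphere_ne_neg (N : sphere (0 : E) 1) : N ≠ -N := fun h => by
  have h' : (N : E) = -N := congrArg Subtype.val h
  have : IsAddTorsionFree E := .of_isTorsionFree ℝ E
  exact ne_zero_of_mem_unit_sphere N (self_eq_neg.1 h')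

/-- Stereographic projection from `N` sends `-N` to `0`, leaving a real vector space of dimension at
least two without its origin. -/
lemma isPreconnected_compl_antipodes (hE : 2 < finrank ℝ E) (N : sphere (0 : E) 1) :
    IsPreconnected ({N}ᶜ ∩ {-N}ᶜ : Set (sphere (0 : E) 1)) := by
  have hf : finrank ℝ E = (finrank ℝ E - 1) + 1 := by omega
  have : Fact (finrank ℝ E = (finrank ℝ E - 1) + 1) := ⟨hf⟩
  have hN : (N : E) ≠ 0 := ne_zero_of_mem_unit_sphere N
  let σ := stereographic (norm_eq_of_mem_sphere N)
  have hsrc : σ.source = {N}ᶜ := stereographic_source _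
  have hrank : 1 < Module.rank ℝ (ℝ ∙ (N : E))ᗮ := by
    have h := Submodule.finrank_orthogonal_span_singleton (𝕜 := ℝ) (n := finrank ℝ E - 1)
       hN
    exact_mod_cast lt_rank_of_lt_finrank (R := ℝ) (M := (ℝ ∙ (N : E))ᗮ) (n := 1) (by omega)
  have h1 := (isConnected_compl_singleton_of_one_lt_rank hrank 0).isPreconnected.image σ.symm
    (σ.continuousOn_invFun.mono (Set.subset_univ _))
  convert! h1 using 1
  have h0 : σ (-N) = 0 := stereographic_apply_neg N
  ext z
  constructor
  · rintro ⟨hz, hz'⟩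
    refine ⟨σ z, fun h => hz' ?_, σ.left_inv (hsrc ▸ hz)⟩
    refine σ.injOn (hsrc ▸ hz) ?_ (h.trans h0.symm)
    rw [hsrc]
    exact (sphere_ne_neg N).symm
  · rintro ⟨w, hw, rfl⟩
    refine ⟨hsrc ▸ σ.map_target (Set.mem_univ w), fun h => hw ?_⟩
    rw [Set.mem_singleton_iff] at h
    rw [Set.mem_singleton_iff, ← h0, ← h]
    exact (σ.right_inv (Set.mem_univ w)).symm

/-- A connected covering of a sphere of dimension at least two is trivial. -/
theorem injective_of_isCoveringMap_sphere (hp : IsCoveringMap p) [PreconnectedSpace X]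
    (hE : 2 < finrank ℝ E) : Function.Injective p := by
  intro x y hxy
  obtain ⟨b, hb⟩ : ∃ b, p x = b := ⟨_, rfl⟩
  -- Seen from `b`, the antipode `-b` has stereographic coordinate `0`; any nonzero coordinate gives
  -- a point other than `±b`.
  obtain ⟨N, h1, h2⟩ : ∃ N : sphere (0 : E) 1, b ≠ N ∧ b ≠ -N := by
    have hf : finrank ℝ E = (finrank ℝ E - 1) + 1 := by omega
    have : Fact (finrank ℝ E = (finrank ℝ E - 1) + 1) := ⟨hf⟩
    have h := Submodule.finrank_orthogonal_span_singleton (𝕜 := ℝ) (n := finrank ℝ E - 1)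
       (ne_zero_of_mem_unit_sphere b)
    have : Nontrivial (ℝ ∙ (b : E))ᗮ := nontrivial_of_finrank_pos (R := ℝ) (by omega)
    obtain ⟨w, hw⟩ := exists_ne (0 : (ℝ ∙ (b : E))ᗮ)
    let σ := stereographic (norm_eq_of_mem_sphere b)
    have hσ : σ (σ.symm w) = w := σ.right_inv (Set.mem_univ w)
    have hmem : σ.symm w ∈ σ.source := σ.map_target (Set.mem_univ w)
    rw [stereographic_source] at hmem
    refine ⟨σ.symm w, fun h => hmem h.symm, fun h => hw ?_⟩
    rw [← hσ, ← neg_neg (σ.symm w), ← h]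
    exact stereographic_apply_neg b
  obtain ⟨s, hs, hsb, hsp⟩ := exists_section_compl_singleton_of_isCoveringMap hp h1 hb
  obtain ⟨t, ht, htb, htp⟩ := exists_section_compl_singleton_of_isCoveringMap hp h2 hb
  -- Both sections start at `x` over `b`, so they agree on the connected overlap and glue to a
  -- global section `g`.
  have hst : Set.EqOn s t ({N}ᶜ ∩ {-N}ᶜ) :=
    hp.eqOn_of_comp_eqOn (isPreconnected_compl_antipodes hE N) (hs.mono Set.inter_subset_left)
      (ht.mono Set.inter_subset_right) (fun z hz => (hsp z hz.1).trans (htp z hz.2).symm)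
      (a := b) ⟨h1, h2⟩ (hsb.trans htb.symm)
  classical
  let g : sphere (0 : E) 1 → X := fun z => if z = N then t z else s z
  have hNN := sphere_ne_neg N
  have hgt : Set.EqOn g t {-N}ᶜ := fun z hz => by
    by_cases h : z = N
    · simp [g, h]
    · simp only [g, if_neg h]
      exact hst ⟨h, hz⟩
  have hgs : Set.EqOn g s {N}ᶜ := fun z hz => by
    simp only [g]
    exact if_neg hz
  have hg : Continuous g := continuous_iff_continuousAt.2 fun z => by
    by_cases h : z = N
    · have hz : ({-N}ᶜ : Set (sphere (0 : E) 1)) ∈ 𝓝 z :=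
        isOpen_compl_singleton.mem_nhds (h ▸ hNN)
      exact (ht.continuousAt hz).congr (Filter.eventuallyEq_of_mem hz hgt).symm
    · have hz : ({N}ᶜ : Set (sphere (0 : E) 1)) ∈ 𝓝 z := isOpen_compl_singleton.mem_nhds h
      exact (hs.continuousAt hz).congr (Filter.eventuallyEq_of_mem hz hgs).symm
  have hpg : ∀ z, p (g z) = z := fun z => by
    by_cases h : z = N
    · rw [hgt (h ▸ hNN), htp z (h ▸ hNN)]
    · rw [hgs h, hsp z h]
  have hgb : g b = x := (hgs h1).trans hsb
  -- Both maps are lifts of `p` and they agree at `x`; as the covering space is connected they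
  -- coincide, so `g` is a left inverse of `p`.
  have key : g ∘ p = id :=
    hp.eq_of_comp_eq (hg.comp hp.continuous) continuous_id (funext fun a => hpg (p a)) x
      (by rw [Function.comp_apply, hb, hgb, id])
  have h3 := congrFun key y
  rw [Function.comp_apply, ← hxy, hb, hgb] at h3
  exact h3

end sphereCovering

/-- For `μ > 1` the circle bundle `S(L^{*μ})` is not homeomorphic to a sphere of the same
dimension. -/
lemma isEmpty_homeomorph_sphere {n μ : ℕ} (hn : 1 ≤ n) (hμ : 1 < μ) :
    IsEmpty (CircleBundle n μ ≃ₜ Sphere n) := by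
  refine ⟨fun h => ?_⟩
  have : NeZero μ := ⟨by omega⟩
  have hE : 2 < Module.finrank ℝ (Amb n) := by
    rw [Fact.out (p := Module.finrank ℝ (Amb n) = (2 * n + 1) + 1)]
    omega
  have hrank : 1 < Module.rank ℝ (Amb n) := by
    exact_mod_cast Module.lt_rank_of_lt_finrank (R := ℝ) (M := Amb n) (n := 1) (by omega)
  have : PreconnectedSpace (Sphere n) :=
    Subtype.preconnectedSpace (isPreconnected_sphere hrank 0 1)
  have hcov : IsCoveringMap (((lensDiffeomorph n μ).toHomeomorph.trans h) ∘
      (Quotient.mk'' : Sphere n → LensSpace n μ)) := isCoveringMap_lensMk.homeomorph_comp _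
  have hinj := (injective_of_isCoveringMap_sphere hcov hE).of_comp
  obtain ⟨z⟩ : Nonempty (Sphere n) := ⟨unitAffineVec 0 0⟩
  have hcard := Complex.card_rootsOfUnity μ
  have : Nontrivial (rootsOfUnity μ ℂ) := by
    by_contra h
    rw [not_nontrivial_iff_subsingleton] at h
    have := Nat.card_eq_one_iff_unique.2 ⟨h, ⟨1⟩⟩
    omega
  obtain ⟨ζ, hζ⟩ := exists_ne (1 : rootsOfUnity μ ℂ)
  -- The points `ζ z` and `z` have the same class, so injectivity gives `ζ z = z`, against freeness
  -- of the action.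
  refine hζ (IsCancelSMul.right_cancel ζ 1 z ?_)
  rw [one_smul]
  exact hinj (Quotient.sound ⟨ζ, rfl⟩)

end ProjLineBundle

end

open ProjLineBundle in
theorem corollary3 (n : ℕ) (hn : 1 ≤ n) :
    (∀ μ : ℕ, (∃ K, IsSzegoKernel n μ K) ∧ ∀ K, IsSzegoKernel n μ K → HasNoLogTerm n μ K) ∧
    (∀ (μ : ℕ) [NeZero μ],
      ∃ Φ : LensSpace n μ ≃ₘ^∞⟮𝓡 (2 * n + 1), circleModel n⟯ CircleBundle n μ,
        ∀ z : Sphere n, Φ (Quotient.mk'' z) = CircleBundle.ofVec (z : Amb n) z.ne_zero 1) ∧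
    (∀ μ : ℕ, 1 < μ →
      IsEmpty (CircleBundle n μ ≃ₘ^∞⟮circleModel n, 𝓡 (2 * n + 1)⟯ Sphere n)) :=
  ⟨fun μ => ⟨exists_isSzegoKernel n μ, fun _ hK => hK.hasNoLogTerm⟩,
    fun μ _ => ⟨lensDiffeomorph n μ, lensDiffeomorph_mk⟩,
    fun _ hμ => ⟨fun h => (isEmpty_homeomorph_sphere hn hμ).false h.toHomeomorph⟩⟩
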